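/- Let $(R,\mathfrak m)$ be a commutative Noetherian local ring and $M$ a finitely generated $R$-module of dimension $d$. Let $$\mathcal D:\quad H^0_{\mathfrak m}(M)=D_0\subset D_1\subset\dots\subset D_t=M$$ be the dimension filtration of $M$, that is, the unique finite filtration by submodules with $D_0=H^0_{\mathfrak m}(M)=\bigcup_{k}(0:_M\mathfrak m^k)$, $D_t=M$, such that for each $i=1,\dots,t$ the module $D_{i-1}$ is the largest submodule of $D_i$ of dimension strictly smaller than $\dim D_i$. Here the zero module is regarded as having smaller dimension than every nonzero module. Put $d_i=\dim D_i$ (with the value $0$ for a zero module), $\mathcal D_0=D_0$ and $\mathcal D_i=D_i/D_{i-1}$ for $i=1,\dots,t$, and write $\ell$ for length. The module $M$ is called sequentially Cohen–Macaulay if $D_i/D_{i-1}$ is Cohen–Macaulay for all $i=1,\dots,t$. A system of parameters of $M$ is a sequence $x_1,\dots,x_d$ of $d=\dim M$ elements of $\mathfrak m$ such that $M/(x_1,\dots,x_d)M$ has finite length; it is called good if $D_i\cap(x_{d_i+1},\dots,x_d)M=0$ for all $i=0,\dots,t-1$. A good parameter ideal of $M$ is an ideal of $R$ generated by a good system of parameters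 of $M$. **Theorem 4.3.** The following statements are equivalent: (i) $M$ is sequentially Cohen–Macaulay. (ii) For every good parameter ideal $\mathfrak q$ of $M$, $$\ell(M/\mathfrak q^{n+1}M)=\sum_{i=0}^{t}\binom{n+d_i}{d_i}\,\ell(\mathcal D_i/\mathfrak q\mathcal D_i)\qquad\text{for all } n\ge 0.$$ (iii) There exists a good parameter ideal $\mathfrak q$ of $M$ such that $$\ell(M/\mathfrak q^{n+1}M)=\sum_{i=0}^{t}\binom{n+d_i}{d_i}\,\ell(\mathcal D_i/\mathfrak q\mathcal D_i)\qquad\text{for all } n\ge 0.$$ -/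

import Mathlib

namespace SeqCM

open IsLocalRing

section

variable (R : Type*) [CommRing R]

/-- The Krull dimension of a module as a natural number. For a nonzero finitely generated module over
a Noetherian local ring this is the usual Krull dimension; the zero module is given the value `0`.
(Inequalities between dimensions are stated with `Module.supportDim`, where the zero module has
dimension `⊥`, strictly less than that of every nonzero module.) -/
noncomputable def dim (N : Type*) [AddCommGroup N] [Module R N] : ℕ :=
  ((Module.supportDim R N).unbotD 0).toNat

variable [IsLocalRing R]

/-- The depth of a module over a local ring: the supremum of the lengths of the regular sequences on
the module that consist of elements of the maximal ideal. -/
noncomputable def depth (N : Type*) [AddCommGroup N] [Module R N] : ℕ∞ :=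
  ⨆ rs : {rs : List R // (∀ r ∈ rs, r ∈ maximalIdeal R) ∧ RingTheory.Sequence.IsRegular N rs},
    (rs.1.length : ℕ∞)

/-- A (finitely generated) module over a (Noetherian) local ring is Cohen-Macaulay if it is zero or
its depth equals its Krull dimension. -/
def IsCohenMacaulay (N : Type*) [AddCommGroup N] [Module R N] : Prop :=
  Subsingleton N ∨ (depth R N : WithBot ℕ∞) = Module.supportDim R N

variable (M : Type*) [AddCommGroup M] [Module R M]

/-- A dimension filtration `H⁰_𝔪(M) = D₀ ⊂ D₁ ⊂ ⋯ ⊂ D_t = M`: for `i = 1, …, t`, the module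
`D_{i-1}` is the largest submodule of `D_i` of dimension strictly less than `dim D_i`.
Here `H⁰_𝔪(M)` is the submodule of the elements killed by a power of the maximal ideal. -/
structure DimensionFiltration where
  /-- the length `t` of the filtration -/
  length : ℕ
  /-- the submodules `D₀, …, D_t` -/
  D : Fin (length + 1) → Submodule R M
  D_zero : D 0 = Ideal.primaryComponent M (maximalIdeal R)
  D_last : D (Fin.last length) = ⊤
  isGreatest (i : Fin length) :
    IsGreatest {N : Submodule R M |
      N ≤ D i.succ ∧ Module.supportDim R N < Module.supportDim R (D i.succ)} (D i.castSucc)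

variable {R M}

/-- The successive quotient `𝒟_{i+1} = D_{i+1} / D_i` for `i = 0, …, t - 1`. -/
abbrev DimensionFiltration.Factor (F : DimensionFiltration R M) (i : Fin F.length) : Type _ :=
  F.D i.succ ⧸ (F.D i.castSucc).submoduleOf (F.D i.succ)

variable (R M)

/-- `M` is sequentially Cohen-Macaulay if all quotients `D_i / D_{i-1}`, `i = 1, …, t`, of its
dimension filtration are Cohen-Macaulay. (The dimension filtration exists and is unique, see the
two instances below.) -/
def IsSequentiallyCohenMacaulay : Prop :=
  ∃ F : DimensionFiltration R M, ∀ i : Fin F.length, IsCohenMacaulay R (F.Factor i)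

variable {R}

/-- A system of parameters of `M`: `dim M` elements of the maximal ideal that generate an ideal `𝔮`
with `M / 𝔮 M` of finite length. -/
def IsSystemOfParameters (x : Fin (dim R M) → R) : Prop :=
  (∀ j, x j ∈ maximalIdeal R) ∧
    IsFiniteLength R (M ⧸ (Ideal.span (Set.range x) • ⊤ : Submodule R M))

/-- A good system of parameters of `M`: a system of parameters `x₁, …, x_d` such that
`D_i ∩ (x_{d_i + 1}, …, x_d) M = 0` for `i = 0, …, t - 1`, where `d_i = dim D_i`.
(The indices start from `0` here, so that `x_{d_i + 1}, …, x_d` are the `x j` with `d_i ≤ j`.) -/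
def IsGoodSystemOfParameters (x : Fin (dim R M) → R) : Prop :=
  IsSystemOfParameters M x ∧
    ∃ F : DimensionFiltration R M, ∀ i : Fin F.length,
      F.D i.castSucc ⊓
        (Ideal.span (x '' {j | dim R (F.D i.castSucc) ≤ (j : ℕ)}) • ⊤ : Submodule R M) = ⊥

/-- A good parameter ideal of `M`: an ideal generated by a good system of parameters of `M`. -/
def IsGoodParameterIdeal (q : Ideal R) : Prop :=
  ∃ x : Fin (dim R M) → R, IsGoodSystemOfParameters M x ∧ q = Ideal.span (Set.range x)

variable {M}

/-- The identity `ℓ(M / 𝔮ⁿ⁺¹ M) = ∑_{i=0}^t C(n + d_i, d_i) ℓ(𝒟_i / 𝔮 𝒟_i)`, with `𝒟₀ = D₀`,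
`𝒟_i = D_i / D_{i-1}` for `i ≥ 1`, and `d_i = dim D_i`. -/
def HilbertSamuelIdentity (F : DimensionFiltration R M) (q : Ideal R) (n : ℕ) : Prop :=
  Module.length R (M ⧸ (q ^ (n + 1) • ⊤ : Submodule R M)) =
    ((n + dim R (F.D 0)).choose (dim R (F.D 0)) : ℕ∞) *
        Module.length R (F.D 0 ⧸ (q • ⊤ : Submodule R (F.D 0))) +
      ∑ i : Fin F.length,
        ((n + dim R (F.D i.succ)).choose (dim R (F.D i.succ)) : ℕ∞) *
          Module.length R (F.Factor i ⧸ (q • ⊤ : Submodule R (F.Factor i)))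

end

section WellDefined

variable {R : Type*} [CommRing R] {M : Type*} [AddCommGroup M] [Module R M]

lemma chain_unique {t : ℕ} : ∀ {t' : ℕ} {D : Fin (t + 1) → Submodule R M}
    {D' : Fin (t' + 1) → Submodule R M}, D 0 = D' 0 → D (Fin.last t) = D' (Fin.last t') →
    (∀ i : Fin t, IsGreatest {N : Submodule R M | N ≤ D i.succ ∧
      Module.supportDim R N < Module.supportDim R (D i.succ)} (D i.castSucc)) →
    (∀ i : Fin t', IsGreatest {N : Submodule R M | N ≤ D' i.succ ∧
      Module.supportDim R N < Module.supportDim R (D' i.succ)} (D' i.castSucc)) →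
    t = t' ∧ HEq D D' := by
  have key : ∀ {s : ℕ} {E : Fin (s + 1 + 1) → Submodule R M},
      (∀ i : Fin (s + 1), IsGreatest {N : Submodule R M | N ≤ E i.succ ∧
        Module.supportDim R N < Module.supportDim R (E i.succ)} (E i.castSucc)) →
      E 0 ≠ E (Fin.last (s + 1)) := by
    intro s E hE h
    have hm : Monotone E := Fin.monotone_iff_le_succ.2 fun i => (hE i).1.1
    have h1 := (hE (Fin.last s)).1
    rw [Fin.succ_last, ← h] at h1
    have : E (Fin.last s).castSucc = E 0 := le_antisymm h1.1 (hm (Fin.zero_le _))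
    rw [this] at h1
    exact lt_irrefl _ h1.2
  induction t with
  | zero =>
    intro t' D D' h0 hl _ hD'
    cases t' with
    | zero => exact ⟨rfl, heq_of_eq (funext fun i => by obtain rfl := Fin.fin_one_eq_zero i; exact h0)⟩
    | succ s => exact absurd (h0.symm.trans hl) (key hD')
  | succ t ih =>
    intro t' D D' h0 hl hD hD'
    cases t' with
    | zero => exact absurd (h0.trans hl.symm) (key hD)
    | succ s =>
      have h1 := hD (Fin.last t)
      have h2 := hD' (Fin.last s)
      rw [Fin.succ_last] at h1 h2
      rw [hl] at h1
      have h3 := h1.unique h2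
      obtain ⟨rfl, h4⟩ := ih (D := fun i => D i.castSucc) (D' := fun i => D' i.castSucc) h0 h3
        (fun i => hD i.castSucc) (fun i => hD' i.castSucc)
      refine ⟨rfl, heq_of_eq (funext fun i => ?_)⟩
      induction i using Fin.lastCases with
      | last => exact hl
      | cast i => exact congrFun (eq_of_heq h4) i

/-- The dimension filtration is unique. -/
instance [IsLocalRing R] : Subsingleton (DimensionFiltration R M) := by
  refine ⟨fun F G => ?_⟩
  obtain ⟨t, D, h0, hl, hD⟩ := F
  obtain ⟨t', D', h0', hl', hD'⟩ := G
  obtain ⟨rfl, h⟩ := chain_unique (h0.trans h0'.symm) (hl.trans hl'.symm) hD hD'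
  obtain rfl := eq_of_heq h
  rfl

lemma supportDim_sup_lt {A B : Submodule R M} {c : WithBot ℕ∞}
    (hA : Module.supportDim R A < c) (hB : Module.supportDim R B < c) :
    Module.supportDim R (A ⊔ B : Submodule R M) < c := by
  refine lt_of_le_of_lt ?_ (max_lt hA hB)
  have hs : Module.support R (A ⊔ B : Submodule R M) ⊆ Module.support R A ∪ Module.support R B := by
    have hf : Function.Surjective ((A.subtype.coprod B.subtype).rangeRestrict) :=
      LinearMap.surjective_rangeRestrict _
    have h2 : (A.subtype.coprod B.subtype).range = A ⊔ B := by
      rw [LinearMap.range_coprod, Submodule.range_subtype, Submodule.range_subtype]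
    have h1 := Module.support_subset_of_surjective _ hf
    rw [h2] at h1
    refine h1.trans (Eq.subset ?_)
    exact Module.support_of_exact (f := LinearMap.inl R A B) (g := LinearMap.snd R A B)
      (Function.Exact.inl_snd) LinearMap.inl_injective LinearMap.snd_surjective
  refine iSup_le fun p => ?_
  have up : ∀ C : Submodule R M, p.head.1 ∈ Module.support R C →
      (p.length : WithBot ℕ∞) ≤ Module.supportDim R C := by
    intro C hC
    exact Order.LTSeries.length_le_krullDim (α := Module.support R C)
      { length := p.length
        toFun := fun i => ⟨(p i).1, Module.mem_support_mono (LTSeries.head_le p i) hC⟩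
        step := fun i => p.step i }
  rcases hs p.head.2 with h | h
  · exact (up A h).trans (le_max_left _ _)
  · exact (up B h).trans (le_max_right _ _)

lemma supportDim_primaryComponent_le_zero [IsLocalRing R] :
    Module.supportDim R (Ideal.primaryComponent M (maximalIdeal R)) ≤ 0 := by
  refine (Order.krullDim_nonpos_iff_forall_isMax).2 fun p q _ => ?_
  have : p.1.asIdeal = maximalIdeal R := by
    obtain ⟨z, hz⟩ := Module.mem_support_iff_exists_annihilator.1 p.2
    obtain ⟨n, hn⟩ := (Ideal.primaryComponent_mem _ _ _).1 z.2
    refine le_antisymm (le_maximalIdeal p.1.isPrime.ne_top)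
      (p.1.isPrime.le_of_pow_le (n := n) (le_trans (fun a ha => ?_) hz))
    rw [Submodule.mem_annihilator_span_singleton]
    exact Subtype.ext ((Submodule.mem_torsionBySet_iff _ _).1 hn ⟨a, ha⟩)
  change q.1.asIdeal ≤ p.1.asIdeal
  rw [this]
  exact le_maximalIdeal q.1.isPrime.ne_top

variable [IsNoetherianRing R] [IsLocalRing R] [Module.Finite R M]

lemma le_primaryComponent_of_supportDim_le_zero {N : Submodule R M}
    (h : Module.supportDim R N ≤ 0) : N ≤ Ideal.primaryComponent M (maximalIdeal R) := by
  intro y hy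
  rw [Ideal.primaryComponent_mem]
  by_cases hN : Subsingleton N
  · refine ⟨0, ?_⟩
    have : (⟨y, hy⟩ : N) = 0 := Subsingleton.elim _ _
    have : y = 0 := congrArg Subtype.val this
    subst this
    exact zero_mem _
  · rw [not_subsingleton_iff_nontrivial] at hN
    have h0 : Module.supportDim R N = 0 := by
      refine le_antisymm h ?_
      have : Nonempty (Module.support R N) := Module.nonempty_support_of_nontrivial.to_subtype
      exact Order.krullDim_nonneg
    have h1 := support_of_supportDim_eq_zero R N h0
    rw [Module.support_eq_zeroLocus] at h1
    have h2 : maximalIdeal R ≤ (Module.annihilator R N).radical := by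
      rw [← PrimeSpectrum.zeroLocus_subset_zeroLocus_iff, h1]
    obtain ⟨k, hk⟩ := Ideal.exists_pow_le_of_le_radical_of_fg h2 (IsNoetherian.noetherian _)
    refine ⟨k, ?_⟩
    rw [Submodule.mem_torsionBySet_iff]
    rintro ⟨a, ha⟩
    exact congrArg Subtype.val (Module.mem_annihilator.1 (hk ha) ⟨y, hy⟩)

/-- The dimension filtration exists. -/
instance : Nonempty (DimensionFiltration R M) := by
  set H := Ideal.primaryComponent M (maximalIdeal R) with hH
  suffices ∀ N : Submodule R M, H ≤ N → ∃ (t : ℕ) (D : Fin (t + 1) → Submodule R M),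
      D 0 = H ∧ D (Fin.last t) = N ∧ ∀ i : Fin t, IsGreatest {N : Submodule R M |
        N ≤ D i.succ ∧ Module.supportDim R N < Module.supportDim R (D i.succ)} (D i.castSucc) by
    obtain ⟨t, D, h0, hl, hD⟩ := this ⊤ le_top
    exact ⟨⟨t, D, h0, hl, hD⟩⟩
  have hnoeth : IsNoetherian R M := isNoetherian_of_isNoetherianRing_of_finite R M
  intro N
  induction h : Module.supportDim R N using WellFoundedLT.induction generalizing N with
  | ind e ih =>
    subst h
    intro hN
    by_cases hNH : N = H
    · exact ⟨0, fun _ => H, rfl, hNH.symm, fun i => i.elim0⟩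
    · have hpos : 0 < Module.supportDim R N := by
        by_contra hc
        exact hNH (le_antisymm (le_primaryComponent_of_supportDim_le_zero (not_lt.1 hc)) hN)
      let S : Set (Submodule R M) :=
        {K | K ≤ N ∧ Module.supportDim R K < Module.supportDim R N}
      have hHS : H ∈ S := ⟨hN, lt_of_le_of_lt supportDim_primaryComponent_le_zero hpos⟩
      obtain ⟨L, hLS, hL⟩ := set_has_maximal_iff_noetherian.2 hnoeth S ⟨H, hHS⟩
      have hgr : IsGreatest S L := by
        refine ⟨hLS, fun K hK => ?_⟩
        have hmem : L ⊔ K ∈ S := ⟨sup_le hLS.1 hK.1, supportDim_sup_lt hLS.2 hK.2⟩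
        have := hL _ hmem
        have h2 : L = L ⊔ K := by
          by_contra hne
          exact this (lt_of_le_of_ne le_sup_left hne)
        rw [h2]
        exact le_sup_right
      obtain ⟨t, D, h0, hl, hD⟩ := ih _ hLS.2 L rfl (hgr.2 hHS)
      refine ⟨t + 1, Fin.snoc (α := fun _ => Submodule R M) D N, ?_, ?_, fun i => ?_⟩
      · rw [← Fin.castSucc_zero, Fin.snoc_castSucc, h0]
      · rw [Fin.snoc_last]
      · induction i using Fin.lastCases with
        | last =>
          rw [Fin.succ_last, Fin.snoc_last, Fin.snoc_castSucc, hl]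
          exact hgr
        | cast i =>
          rw [Fin.succ_castSucc, Fin.snoc_castSucc, Fin.snoc_castSucc]
          exact hD i

end WellDefined

end SeqCM

/-!
# Sequentially Cohen-Macaulay modules and the lengths `ℓ(M / 𝔮ⁿ⁺¹ M)`

If `𝔮` is generated by a good system of parameters `x₁, …, x_d`, then `x_j` kills `D_i` for
`j > d_i`, since `x_j D_i` lies in `D_i ∩ (x_{d_i + 1}, …, x_d) M = 0`. So on `D_i` and on
`𝒟_i = D_i / D_{i-1}` the ideal `𝔮` acts like `𝔮_i = (x₁, …, x_{d_i})`, which has as many generators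
as the dimension `d_i` of `𝒟_i`.

The module `𝒟_i` is Cohen-Macaulay iff `x₁, …, x_{d_i}` is regular on it. The link to lengths is the
exact sequence `N / 𝔮ⁿ N → N / 𝔮ⁿ⁺¹ N → N' / 𝔮'ⁿ⁺¹ N' → 0` given by multiplication by the first
generator `x`, where `N' = N / x N` and `𝔮'` is generated by the others (`exists_length_add_eq`). By
induction it gives `ℓ(N / 𝔮ⁿ⁺¹ N) ≤ C(n + d, d) ℓ(N / 𝔮 N)` for every `N` and every `𝔮` with `d`
generators (`length_quotient_pow_le`). If equality holds for all `n`, then the first map is always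
injective, and Krull's intersection theorem makes the generators a regular sequence
(`isWeaklyRegular_of_length_eq`). Conversely, for a regular sequence the first map is injective
(`mem_pow_smul_of_smul_mem_pow_succ`, `mem_pow_smul_of_smul_mem`), and equality holds
(`length_quotient_pow_eq`).

If all `𝒟_i` are Cohen-Macaulay, then moreover `𝔮ⁿ⁺¹ D_i ∩ D_{i-1} = 𝔮ⁿ⁺¹ D_{i-1}`
(`pow_smul_top_inf_le_of_isWeaklyRegular`), so that the lengths for the `𝒟_i` add up to
`ℓ(M / 𝔮ⁿ⁺¹ M)`. That a system of parameters is regular on a Cohen-Macaulay module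
(`isWeaklyRegular_of_supportDim_quotient_le_zero`) follows from the Rees theorem and the bound of
the depth by the dimensions of the associated primes. In the other direction, lengths are subadditive in
any case, so if the identity holds, then each of the inequalities
`ℓ(𝒟_i / 𝔮ⁿ⁺¹ 𝒟_i) ≤ C(n + d_i, d_i) ℓ(𝒟_i / 𝔮 𝒟_i)` is an equality, and all `𝒟_i` are
Cohen-Macaulay.

Finally, good systems of parameters exist (`exists_isGoodSystemOfParameters`): by the Artin-Rees
lemma a power of the annihilator of `D_i` moves `M` into a submodule that meets `D_i` trivially, and
by prime avoidance the parameters can be taken from these powers.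
-/

namespace SeqCM

open IsLocalRing RingTheory.Sequence
open scoped Pointwise

/-! ### Powers of an ideal and multiplication by one of its generators -/

section Length

variable {R : Type*} [CommRing R]

lemma span_singleton_sup_pow_succ (x : R) (J : Ideal R) (n : ℕ) :
    (Ideal.span {x} ⊔ J) ^ (n + 1) = Ideal.span {x} * (Ideal.span {x} ⊔ J) ^ n ⊔ J ^ (n + 1) := by
  set q := Ideal.span {x} ⊔ J with hq
  refine le_antisymm ?_ (sup_le ?_ (Ideal.pow_right_mono le_sup_right _))
  · induction n with
    | zero => simp [hq]
    | succ n ih =>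
      rw [pow_succ' q (n + 1)]
      conv_lhs => rw [hq]
      rw [Ideal.sup_mul, ← hq]
      refine sup_le le_sup_left ?_
      refine (Ideal.mul_mono_right ih).trans ?_
      rw [Ideal.mul_sup, ← pow_succ']
      refine sup_le_sup_right ?_ _
      rw [mul_left_comm, pow_succ' q n]
      exact Ideal.mul_mono_right (Ideal.mul_mono_left le_sup_right)
  · rw [pow_succ']
    exact Ideal.mul_mono_left le_sup_left

variable {N : Type*} [AddCommGroup N] [Module R N]

lemma exists_of_mem_span_singleton_sup_pow_smul {x : R} {J : Ideal R} {n : ℕ} {z : N}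
    (hz : z ∈ (Ideal.span {x} ⊔ J) ^ (n + 1) • (⊤ : Submodule R N)) :
    ∃ u ∈ (Ideal.span {x} ⊔ J) ^ n • (⊤ : Submodule R N),
      ∃ a ∈ J ^ (n + 1) • (⊤ : Submodule R N), x • u + a = z := by
  rw [span_singleton_sup_pow_succ, Submodule.sup_smul, Submodule.mul_smul,
    Submodule.ideal_span_singleton_smul, Submodule.mem_sup] at hz
  obtain ⟨y, hy, a, ha, rfl⟩ := hz
  obtain ⟨u, hu, rfl⟩ := (Submodule.mem_smul_pointwise_iff_exists _ _ _).1 hy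
  exact ⟨u, hu, a, ha, rfl⟩

lemma smul_mem_span_singleton_sup_pow_smul {x : R} {J : Ideal R} {n : ℕ} {u : N}
    (hu : u ∈ (Ideal.span {x} ⊔ J) ^ n • (⊤ : Submodule R N)) :
    x • u ∈ (Ideal.span {x} ⊔ J) ^ (n + 1) • (⊤ : Submodule R N) := by
  rw [pow_succ', Submodule.mul_smul]
  exact Submodule.smul_mem_smul (Ideal.mem_sup_left (Ideal.mem_span_singleton_self x)) hu

lemma mk_mem_smul_top_iff {J : Ideal R} {P : Submodule R N} {z : N} :
    (Submodule.Quotient.mk z : N ⧸ P) ∈ J • (⊤ : Submodule R (N ⧸ P)) ↔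
      z ∈ P ⊔ J • (⊤ : Submodule R N) := by
  have h := Submodule.comap_smul_top_of_surjective J P.mkQ P.mkQ_surjective
  rw [Submodule.ker_mkQ, sup_comm] at h
  rw [← h, Submodule.mem_comap, Submodule.mkQ_apply]

/-- Multiplication by `x` fits into an exact sequence
`N / 𝔮ⁿ N → N / 𝔮ⁿ⁺¹ N → N' / J ^ (n + 1) N' → 0`, where `𝔮 = (x) + J` and `N' = N / x N`. -/
lemma exists_length_add_eq (x : R) (J : Ideal R) (n : ℕ) :
    ∃ f : (N ⧸ (Ideal.span {x} ⊔ J) ^ n • (⊤ : Submodule R N)) →ₗ[R]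
        N ⧸ (Ideal.span {x} ⊔ J) ^ (n + 1) • (⊤ : Submodule R N),
      (∀ z, f (Submodule.Quotient.mk z) = Submodule.Quotient.mk (x • z)) ∧
      Module.length R (N ⧸ (Ideal.span {x} ⊔ J) ^ n • (⊤ : Submodule R N)) +
        Module.length R (QuotSMulTop x N ⧸ J ^ (n + 1) • (⊤ : Submodule R (QuotSMulTop x N))) =
      Module.length R (LinearMap.ker f) +
        Module.length R (N ⧸ (Ideal.span {x} ⊔ J) ^ (n + 1) • (⊤ : Submodule R N)) := by
  set A := (Ideal.span {x} ⊔ J) ^ n • (⊤ : Submodule R N) with hA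
  set B := (Ideal.span {x} ⊔ J) ^ (n + 1) • (⊤ : Submodule R N) with hB
  set C := J ^ (n + 1) • (⊤ : Submodule R (QuotSMulTop x N)) with hC
  let f : (N ⧸ A) →ₗ[R] N ⧸ B := A.mapQ B (LinearMap.lsmul R N x) fun u hu =>
    smul_mem_span_singleton_sup_pow_smul hu
  have hBC : ∀ z, (Submodule.Quotient.mk z : QuotSMulTop x N) ∈ C ↔ ∃ u, z - x • u ∈ B := by
    intro z
    rw [hC, mk_mem_smul_top_iff, Submodule.mem_sup]
    constructor
    · rintro ⟨y, hy, a, ha, rfl⟩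
      obtain ⟨u, -, rfl⟩ := (Submodule.mem_smul_pointwise_iff_exists _ _ _).1 hy
      exact ⟨u, by simpa using
        Submodule.smul_mono_left (Ideal.pow_right_mono le_sup_right _) ha⟩
    · rintro ⟨u, hu⟩
      obtain ⟨v, -, a, ha, h⟩ := exists_of_mem_span_singleton_sup_pow_smul hu
      exact ⟨x • (u + v), Submodule.smul_mem_pointwise_smul _ _ _ trivial, a, ha,
        by rw [smul_add, add_assoc, h]; abel⟩
  let g : (N ⧸ B) →ₗ[R] QuotSMulTop x N ⧸ C :=
    B.mapQ C (x • (⊤ : Submodule R N)).mkQ fun u hu => (hBC u).2 ⟨0, by simpa using hu⟩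
  have hg : Function.Surjective g := by
    intro y
    obtain ⟨y, rfl⟩ := Submodule.Quotient.mk_surjective _ y
    obtain ⟨y, rfl⟩ := Submodule.Quotient.mk_surjective _ y
    exact ⟨Submodule.Quotient.mk y, rfl⟩
  have hfg : Function.Exact (LinearMap.range f).subtype g := by
    intro z
    obtain ⟨z, rfl⟩ := Submodule.Quotient.mk_surjective _ z
    have h1 : g (Submodule.Quotient.mk z) = 0 ↔ (Submodule.Quotient.mk z : QuotSMulTop x N) ∈ C :=
      Submodule.Quotient.mk_eq_zero _
    rw [h1, hBC]
    constructor
    · rintro ⟨u, hu⟩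
      exact ⟨⟨_, Submodule.Quotient.mk u, rfl⟩, ((Submodule.Quotient.eq B).2 hu).symm⟩
    · rintro ⟨⟨_, u, rfl⟩, h⟩
      obtain ⟨u, rfl⟩ := Submodule.Quotient.mk_surjective _ u
      exact ⟨u, (Submodule.Quotient.eq B).1 h.symm⟩
  refine ⟨f, fun _ => rfl, ?_⟩
  rw [Module.length_eq_add_of_exact _ g (Submodule.subtype_injective _) hg hfg,
    Module.length_eq_add_of_exact (LinearMap.ker f).subtype f.rangeRestrict
      (Submodule.subtype_injective _) f.surjective_rangeRestrict
      (by rw [LinearMap.exact_iff, LinearMap.ker_rangeRestrict, Submodule.range_subtype]),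
    add_assoc]

lemma length_quotSMulTop_quotient (x : R) (xs : List R) :
    Module.length R (QuotSMulTop x N ⧸ Ideal.ofList xs • (⊤ : Submodule R (QuotSMulTop x N))) =
      Module.length R (N ⧸ Ideal.ofList (x :: xs) • (⊤ : Submodule R N)) :=
  (Submodule.quotOfListConsSMulTopEquivQuotSMulTopInner N x xs).symm.length_eq

lemma choose_succ_add_eq (n d : ℕ) :
    (n + 1 + (d + 1)).choose (d + 1) = (n + (d + 1)).choose (d + 1) + (n + 1 + d).choose d := by
  rw [show n + 1 + (d + 1) = n + (d + 1) + 1 by ring, Nat.choose_succ_succ, add_comm,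
    show n + (d + 1) = n + 1 + d by ring]

/-- If `𝔮` is generated by `d` elements, then `ℓ(N / 𝔮ⁿ⁺¹ N) ≤ C(n + d, d) ℓ(N / 𝔮 N)`. -/
lemma length_quotient_pow_le (xs : List R) (n : ℕ) :
    Module.length R (N ⧸ Ideal.ofList xs ^ (n + 1) • (⊤ : Submodule R N)) ≤
      ((n + xs.length).choose xs.length : ℕ∞) *
        Module.length R (N ⧸ Ideal.ofList xs • (⊤ : Submodule R N)) := by
  induction xs generalizing N n with
  | nil =>
    rw [Ideal.ofList_nil, Ideal.bot_pow n.succ_ne_zero]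
    simp
  | cons x xs ihx =>
    induction n with
    | zero =>
      rw [zero_add 1, pow_one]
      simp [-Ideal.ofList_cons]
    | succ n ihn =>
      obtain ⟨f, -, h⟩ := exists_length_add_eq (N := N) x (Ideal.ofList xs) (n + 1)
      rw [Ideal.ofList_cons] at ihn ⊢
      refine (le_add_self.trans_eq h.symm).trans ?_
      refine (add_le_add ihn (ihx (N := QuotSMulTop x N) (n + 1))).trans_eq ?_
      rw [length_quotSMulTop_quotient, Ideal.ofList_cons, ← add_mul, List.length_cons,
        choose_succ_add_eq]
      push_cast
      rfl

end Length

/-! ### Regular sequences and powers of the ideal they generate -/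

section Regular

variable {R : Type*} [CommRing R] [IsLocalRing R] [IsNoetherianRing R]

/-- If the quotients `N / 𝔮ⁿ⁺¹ N` have the largest lengths that the number of generators of `𝔮`
permits, then multiplication by the first generator `x` induces injections
`N / 𝔮ⁿ N → N / 𝔮ⁿ⁺¹ N`; so `x` is regular by Krull's intersection theorem, and `N / x N` inherits
the hypothesis. -/
lemma isWeaklyRegular_of_length_eq {N : Type*} [AddCommGroup N] [Module R N] [Module.Finite R N]
    {xs : List R} (hxs : ∀ x ∈ xs, x ∈ maximalIdeal R)
    (hfin : Module.length R (N ⧸ Ideal.ofList xs • (⊤ : Submodule R N)) ≠ ⊤)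
    (h : ∀ n, Module.length R (N ⧸ Ideal.ofList xs ^ (n + 1) • (⊤ : Submodule R N)) =
      ((n + xs.length).choose xs.length : ℕ∞) *
        Module.length R (N ⧸ Ideal.ofList xs • (⊤ : Submodule R N))) :
    IsWeaklyRegular N xs := by
  induction xs generalizing N with
  | nil => exact .nil R N
  | cons x xs ih =>
    have hfin' : ∀ n, Module.length R
        (N ⧸ Ideal.ofList (x :: xs) ^ n • (⊤ : Submodule R N)) ≠ ⊤ := by
      rintro (_ | n)
      · rw [pow_zero, Ideal.one_eq_top, Submodule.top_smul, Module.length_eq_zero]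
        exact ENat.zero_ne_top
      · rw [h]
        exact WithTop.mul_ne_top (ENat.natCast_ne_top _) hfin
    have key : ∀ n, Module.length R
        (QuotSMulTop x N ⧸ Ideal.ofList xs ^ (n + 1) • (⊤ : Submodule R (QuotSMulTop x N))) =
          ((n + xs.length).choose xs.length : ℕ∞) * Module.length R
            (QuotSMulTop x N ⧸ Ideal.ofList xs • (⊤ : Submodule R (QuotSMulTop x N))) ∧
        ∀ z : N, x • z ∈ Ideal.ofList (x :: xs) ^ (n + 1) • (⊤ : Submodule R N) →
          z ∈ Ideal.ofList (x :: xs) ^ n • (⊤ : Submodule R N) := by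
      intro n
      have hex := exists_length_add_eq (N := N) x (Ideal.ofList xs) n
      rw [← Ideal.ofList_cons] at hex
      obtain ⟨f, hf, hl⟩ := hex
      have hle := length_quotient_pow_le (N := QuotSMulTop x N) xs n
      have hstep : Module.length R (N ⧸ Ideal.ofList (x :: xs) ^ (n + 1) • (⊤ : Submodule R N)) =
          Module.length R (N ⧸ Ideal.ofList (x :: xs) ^ n • (⊤ : Submodule R N)) +
          ((n + xs.length).choose xs.length : ℕ∞) * Module.length R
            (QuotSMulTop x N ⧸ Ideal.ofList xs • (⊤ : Submodule R (QuotSMulTop x N))) := by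
        rw [length_quotSMulTop_quotient, h]
        cases n with
        | zero => simp
        | succ n =>
          rw [h, ← add_mul, List.length_cons, choose_succ_add_eq]
          push_cast
          rfl
      have hcancel := hfin' n
      have hmul : ((n + xs.length).choose xs.length : ℕ∞) * Module.length R
            (QuotSMulTop x N ⧸ Ideal.ofList xs • (⊤ : Submodule R (QuotSMulTop x N))) ≠ ⊤ := by
        rw [length_quotSMulTop_quotient]
        exact WithTop.mul_ne_top (ENat.natCast_ne_top _) hfin
      rw [hstep] at hl
      generalize Module.length R (N ⧸ Ideal.ofList (x :: xs) ^ n • (⊤ : Submodule R N)) = a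
        at hl hcancel
      generalize ((n + xs.length).choose xs.length : ℕ∞) * Module.length R
            (QuotSMulTop x N ⧸ Ideal.ofList xs • (⊤ : Submodule R (QuotSMulTop x N))) = b
        at hl hle hmul ⊢
      generalize hc : Module.length R (QuotSMulTop x N ⧸
        Ideal.ofList xs ^ (n + 1) • (⊤ : Submodule R (QuotSMulTop x N))) = c at hl hle ⊢
      generalize hk : Module.length R (LinearMap.ker f) = k at hl
      have h1 : c = k + b := by
        rw [add_left_comm] at hl
        exact WithTop.add_left_cancel hcancel hl
      have h2 : k = 0 := by
        rw [h1] at hle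
        lift b to ℕ using hmul
        have hk' : k ≠ ⊤ := by rintro rfl; simp at hle
        lift k to ℕ using hk'
        norm_cast at hle ⊢
        omega
      refine ⟨by rw [h1, h2, zero_add], fun z hz => ?_⟩
      rw [h2, Module.length_eq_zero_iff, Submodule.subsingleton_iff_eq_bot] at hk
      rw [← Submodule.Quotient.mk_eq_zero, ← Submodule.mem_bot R, ← hk, LinearMap.mem_ker, hf,
        Submodule.Quotient.mk_eq_zero]
      exact hz
    refine .cons ?_ (ih (fun y hy => hxs y (List.mem_cons_of_mem _ hy)) ?_ fun n => (key n).1)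
    · rw [isSMulRegular_iff_right_eq_zero_of_smul]
      intro z hz
      have hne : Ideal.ofList (x :: xs) ≠ ⊤ := fun h =>
        (maximalIdeal.isMaximal R).ne_top (top_le_iff.1 (h.symm.trans_le (Ideal.span_le.2 hxs)))
      rw [← Submodule.mem_bot R, ← Ideal.iInf_pow_smul_eq_bot_of_isLocalRing _ hne,
        Submodule.mem_iInf]
      exact fun n => (key n).2 z (hz ▸ zero_mem _)
    · rw [length_quotSMulTop_quotient]
      exact hfin

omit [IsLocalRing R] [IsNoetherianRing R] in
/-- If `x` is regular on all `N / Jⁿ N`, then multiplication by `x` induces injections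
`N / 𝔮ⁿ N → N / 𝔮ⁿ⁺¹ N` for `𝔮 = (x) + J`. -/
lemma mem_pow_smul_of_smul_mem_pow_succ {N : Type*} [AddCommGroup N] [Module R N]
    {x : R} {J : Ideal R}
    (hreg : ∀ (n : ℕ) (z : N), x • z ∈ J ^ n • (⊤ : Submodule R N) →
      z ∈ J ^ n • (⊤ : Submodule R N)) (n : ℕ) {z : N}
    (hz : x • z ∈ (Ideal.span {x} ⊔ J) ^ (n + 1) • (⊤ : Submodule R N)) :
    z ∈ (Ideal.span {x} ⊔ J) ^ n • (⊤ : Submodule R N) := by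
  obtain ⟨u, hu, a, ha, h⟩ := exists_of_mem_span_singleton_sup_pow_smul hz
  have h1 : z - u ∈ J ^ (n + 1) • (⊤ : Submodule R N) := by
    refine hreg _ _ ?_
    rw [smul_sub, ← h, add_sub_cancel_left]
    exact ha
  have h2 : z - u ∈ (Ideal.span {x} ⊔ J) ^ n • (⊤ : Submodule R N) :=
    Submodule.smul_mono_left
      ((Ideal.pow_le_pow_right n.le_succ).trans (Ideal.pow_right_mono le_sup_right _)) h1
  simpa using add_mem h2 hu

/-- If `w, x₁, …, xᵣ` is regular on `N`, then `w` is regular on `N / (x₁, …, xᵣ)ⁿ N`. -/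
lemma mem_pow_smul_of_smul_mem {N : Type*} [AddCommGroup N] [Module R N] [Module.Finite R N]
    {w : R} {xs : List R} (hmem : ∀ x ∈ w :: xs, x ∈ maximalIdeal R)
    (hreg : IsWeaklyRegular N (w :: xs)) (n : ℕ) (z : N)
    (hz : w • z ∈ Ideal.ofList xs ^ n • (⊤ : Submodule R N)) :
    z ∈ Ideal.ofList xs ^ n • (⊤ : Submodule R N) := by
  induction xs generalizing N w n z with
  | nil =>
    cases n with
    | zero => simp
    | succ n =>
      rw [Ideal.ofList_nil, Ideal.bot_pow n.succ_ne_zero, Submodule.bot_smul,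
        Submodule.mem_bot] at hz ⊢
      exact ((isWeaklyRegular_cons_iff _ _ _).1 hreg).1.right_eq_zero_of_smul hz
  | cons x xs ih =>
    have hperm : IsWeaklyRegular N (x :: w :: xs) :=
      IsLocalRing.isWeaklyRegular_of_perm_of_subset_maximalIdeal hreg (List.Perm.swap _ _ _) hmem
    have hx : IsWeaklyRegular N (x :: xs) := by
      have h : IsWeaklyRegular N ((x :: xs) ++ [w]) :=
        IsLocalRing.isWeaklyRegular_of_perm_of_subset_maximalIdeal hreg
          (List.perm_append_singleton w (x :: xs)).symm hmem
      exact ((isWeaklyRegular_append_iff _ _ _).1 h).1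
    have hcolon : ∀ (n : ℕ) (z : N),
        x • z ∈ Ideal.ofList (x :: xs) ^ (n + 1) • (⊤ : Submodule R N) →
        z ∈ Ideal.ofList (x :: xs) ^ n • (⊤ : Submodule R N) := by
      intro n z
      rw [Ideal.ofList_cons]
      exact mem_pow_smul_of_smul_mem_pow_succ
        (ih (fun y hy => hmem y (List.mem_cons_of_mem _ hy)) hx) n
    induction n generalizing z with
    | zero => simp
    | succ n ihn =>
      have hle : Ideal.ofList (x :: xs) ^ (n + 1) • (⊤ : Submodule R N) ≤
          x • (⊤ : Submodule R N) ⊔ Ideal.ofList xs ^ (n + 1) • (⊤ : Submodule R N) := by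
        intro y hy
        rw [Ideal.ofList_cons] at hy
        obtain ⟨u, -, a, ha, rfl⟩ := exists_of_mem_span_singleton_sup_pow_smul hy
        exact Submodule.add_mem_sup (Submodule.smul_mem_pointwise_smul _ _ _ trivial) ha
      -- The case of `xs` and `N / x N` gives `z = x u + a` with `a ∈ 𝔮ⁿ⁺¹ N`, and then `x w u` and
      -- hence, successively, `w u` and `u` lie in the expected powers.
      have h1 : (Submodule.Quotient.mk z : QuotSMulTop x N) ∈
          Ideal.ofList xs ^ (n + 1) • (⊤ : Submodule R (QuotSMulTop x N)) := by
        refine ih (w := w) (fun y hy => hmem y ?_) ((isWeaklyRegular_cons_iff _ _ _).1 hperm).2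
          _ _ ?_
        · rw [List.mem_cons] at hy ⊢
          exact hy.imp_right (List.mem_cons_of_mem _)
        · rw [← Submodule.Quotient.mk_smul, mk_mem_smul_top_iff]
          exact hle hz
      rw [mk_mem_smul_top_iff, Submodule.mem_sup] at h1
      obtain ⟨y, hy, a, ha, rfl⟩ := h1
      obtain ⟨u, -, rfl⟩ := (Submodule.mem_smul_pointwise_iff_exists _ _ _).1 hy
      have ha' : a ∈ Ideal.ofList (x :: xs) ^ (n + 1) • (⊤ : Submodule R N) :=
        Submodule.smul_mono_left (Ideal.pow_right_mono (by simp) _) ha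
      refine add_mem ?_ ha'
      have h2 : x • w • u ∈ Ideal.ofList (x :: xs) ^ (n + 1) • (⊤ : Submodule R N) := by
        have h3 := sub_mem hz (Submodule.smul_mem _ w ha')
        rwa [smul_add, add_sub_cancel_right, smul_comm] at h3
      have h4 := ihn u (hcolon n _ h2)
      rw [Ideal.ofList_cons] at h4 ⊢
      exact smul_mem_span_singleton_sup_pow_smul h4

/-- If `x₁, …, x_d` is regular on `N`, then `ℓ(N / 𝔮ⁿ⁺¹ N) = C(n + d, d) ℓ(N / 𝔮 N)` for
`𝔮 = (x₁, …, x_d)`. -/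
lemma length_quotient_pow_eq {N : Type*} [AddCommGroup N] [Module R N] [Module.Finite R N]
    {xs : List R} (hxs : ∀ x ∈ xs, x ∈ maximalIdeal R) (hreg : IsWeaklyRegular N xs) (n : ℕ) :
    Module.length R (N ⧸ Ideal.ofList xs ^ (n + 1) • (⊤ : Submodule R N)) =
      ((n + xs.length).choose xs.length : ℕ∞) *
        Module.length R (N ⧸ Ideal.ofList xs • (⊤ : Submodule R N)) := by
  induction xs generalizing N n with
  | nil =>
    rw [Ideal.ofList_nil, Ideal.bot_pow n.succ_ne_zero]
    simp
  | cons x xs ihx =>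
    induction n with
    | zero =>
      rw [zero_add 1, pow_one]
      simp [-Ideal.ofList_cons]
    | succ n ihn =>
      have ihx' := ihx (N := QuotSMulTop x N) (fun y hy => hxs y (List.mem_cons_of_mem _ hy))
        ((isWeaklyRegular_cons_iff _ _ _).1 hreg).2 (n + 1)
      obtain ⟨f, hf, h⟩ := exists_length_add_eq (N := N) x (Ideal.ofList xs) (n + 1)
      have hker : LinearMap.ker f = ⊥ := by
        rw [LinearMap.ker_eq_bot']
        intro z hz
        obtain ⟨z, rfl⟩ := Submodule.Quotient.mk_surjective _ z
        rw [hf, Submodule.Quotient.mk_eq_zero] at hz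
        rw [Submodule.Quotient.mk_eq_zero]
        exact mem_pow_smul_of_smul_mem_pow_succ (mem_pow_smul_of_smul_mem hxs hreg) _ hz
      rw [hker, Module.length_bot, zero_add] at h
      rw [Ideal.ofList_cons] at ihn ⊢
      rw [← h, ihn, ihx', length_quotSMulTop_quotient, Ideal.ofList_cons, ← add_mul,
        List.length_cons, choose_succ_add_eq]
      push_cast
      rfl

/-- If `xs` is regular on `M / D`, then the `𝔮`-adic filtration of `M` induces that of `D`, for `𝔮`
the ideal generated by `xs`. -/
lemma pow_smul_top_inf_le_of_isWeaklyRegular {M : Type*} [AddCommGroup M] [Module R M]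
    [Module.Finite R M] (D : Submodule R M) {xs : List R} (hxs : ∀ x ∈ xs, x ∈ maximalIdeal R)
    (hreg : IsWeaklyRegular (M ⧸ D) xs) (n : ℕ) :
    Ideal.ofList xs ^ n • (⊤ : Submodule R M) ⊓ D ≤ Ideal.ofList xs ^ n • D := by
  induction xs generalizing n with
  | nil =>
    cases n with
    | zero => simp
    | succ n =>
      rw [Ideal.ofList_nil, Ideal.bot_pow n.succ_ne_zero]
      simp
  | cons x xs ihx =>
    have hxs' : ∀ y ∈ xs, y ∈ maximalIdeal R := fun y hy => hxs y (List.mem_cons_of_mem _ hy)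
    have hreg' : IsWeaklyRegular (M ⧸ D) xs := by
      have h : IsWeaklyRegular (M ⧸ D) (xs ++ [x]) :=
        IsLocalRing.isWeaklyRegular_of_perm_of_subset_maximalIdeal hreg
          (List.perm_append_singleton x xs).symm hxs
      exact ((isWeaklyRegular_append_iff _ _ _).1 h).1
    induction n with
    | zero => simp
    | succ n ihn =>
      rintro y ⟨hy, hyD⟩
      have hle : Ideal.ofList xs ≤ Ideal.ofList (x :: xs) := by simp
      rw [SetLike.mem_coe, Ideal.ofList_cons] at hy
      obtain ⟨u, hu, a, ha, rfl⟩ := exists_of_mem_span_singleton_sup_pow_smul hy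
      rw [← Ideal.ofList_cons] at hu
      -- Modulo `D` the element `x u + a` vanishes, so `x u ∈ 𝔮'ⁿ⁺¹ (M / D)` for the ideal `𝔮'`
      -- generated by `xs`, and `x` can be cancelled.
      have h1 : (Submodule.Quotient.mk u : M ⧸ D) ∈
          Ideal.ofList xs ^ (n + 1) • (⊤ : Submodule R (M ⧸ D)) := by
        refine mem_pow_smul_of_smul_mem hxs hreg _ _ ?_
        rw [← Submodule.Quotient.mk_smul, mk_mem_smul_top_iff]
        have h2 := Submodule.add_mem_sup hyD (neg_mem ha)
        rwa [add_neg_cancel_right] at h2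
      rw [mk_mem_smul_top_iff, Submodule.mem_sup] at h1
      obtain ⟨δ, hδ, v, hv, rfl⟩ := h1
      have hv' : v ∈ Ideal.ofList (x :: xs) ^ n • (⊤ : Submodule R M) :=
        Submodule.smul_mono_left
          ((Ideal.pow_le_pow_right n.le_succ).trans (Ideal.pow_right_mono hle _)) hv
      have h3 : x • δ ∈ Ideal.ofList (x :: xs) ^ (n + 1) • D := by
        rw [pow_succ', Submodule.mul_smul]
        exact Submodule.smul_mem_smul (Ideal.subset_span List.mem_cons_self)
          (ihn ⟨by simpa using sub_mem hu hv', hδ⟩)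
      have h4 : x • v + a ∈ Ideal.ofList xs ^ (n + 1) • D := by
        refine ihx hxs' hreg' _ ⟨add_mem (Submodule.smul_mem _ _ hv) ha, ?_⟩
        have h5 := sub_mem hyD (Submodule.smul_mem D x hδ)
        rwa [smul_add, add_assoc, add_sub_cancel_left] at h5
      rw [smul_add, add_assoc]
      exact add_mem h3 (Submodule.smul_mono_left (Ideal.pow_right_mono hle _) h4)

end Regular

/-! ### Dimensions of supports -/

section Dimension

variable {R : Type*} [CommRing R]

lemma supportDim_le_of_support_subset {N N' : Type*} [AddCommGroup N] [Module R N]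
    [AddCommGroup N'] [Module R N'] (h : Module.support R N ⊆ Module.support R N') :
    Module.supportDim R N ≤ Module.supportDim R N' :=
  Order.krullDim_le_of_strictMono (fun a => ⟨a.1, h a.2⟩) fun {_ _} lt => lt

lemma mem_support_quotient_iff {I : Ideal R} {p : PrimeSpectrum R} :
    p ∈ Module.support R (R ⧸ I) ↔ I ≤ p.asIdeal := by
  rw [Module.support_eq_zeroLocus, Ideal.annihilator_quotient]
  rfl

lemma supportDim_le_iff {N : Type*} [AddCommGroup N] [Module R N] {c : WithBot ℕ∞} :
    Module.supportDim R N ≤ c ↔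
      ∀ p ∈ Module.support R N, Module.supportDim R (R ⧸ p.asIdeal) ≤ c := by
  constructor
  · intro h p hp
    exact (supportDim_le_of_support_subset fun p' hp' =>
      Module.mem_support_mono (mem_support_quotient_iff.1 hp') hp).trans h
  · intro h
    refine iSup_le fun s => ?_
    refine le_trans ?_ (h s.head.1 s.head.2)
    exact Order.LTSeries.length_le_krullDim (α := Module.support R (R ⧸ s.head.1.asIdeal))
      { length := s.length
        toFun := fun i => ⟨(s i).1, mem_support_quotient_iff.2 (LTSeries.head_le s i)⟩
        step := fun i => s.step i }

lemma supportDim_quotient_prime_nonneg (p : PrimeSpectrum R) :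
    0 ≤ Module.supportDim R (R ⧸ p.asIdeal) := by
  have : Nonempty (Module.support R (R ⧸ p.asIdeal)) :=
    ⟨⟨p, mem_support_quotient_iff.2 le_rfl⟩⟩
  exact Order.krullDim_nonneg

lemma supportDim_quotient_mono {I J : Ideal R} (h : I ≤ J) :
    Module.supportDim R (R ⧸ J) ≤ Module.supportDim R (R ⧸ I) :=
  supportDim_le_of_support_subset fun _ hp =>
    mem_support_quotient_iff.2 (h.trans (mem_support_quotient_iff.1 hp))

lemma supportDim_quotient_add_one_le {p q : PrimeSpectrum R} (h : p < q) :
    Module.supportDim R (R ⧸ q.asIdeal) + 1 ≤ Module.supportDim R (R ⧸ p.asIdeal) := by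
  obtain ⟨y, hyq, hyp⟩ := SetLike.exists_of_lt (show p.asIdeal < q.asIdeal from h)
  have h1 : Module.supportDim R (R ⧸ q.asIdeal) ≤
      Module.supportDim R (QuotSMulTop y (R ⧸ p.asIdeal)) := by
    refine supportDim_le_of_support_subset fun p' hp' => ?_
    rw [mem_support_quotient_iff] at hp'
    rw [Module.support_quotSMulTop]
    exact ⟨mem_support_quotient_iff.2 (h.le.trans hp'), by simpa using hp' hyq⟩
  refine (add_le_add_left h1 1).trans
    (Module.supportDim_quotSMulTop_succ_le_of_notMem_minimalPrimes fun r hr => ?_)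
  rw [Ideal.annihilator_quotient, Ideal.minimalPrimes_eq_subsingleton_self] at hr
  rwa [Set.mem_singleton_iff.1 hr]

/-- Here the support of `M` is the union of the supports of `D` and `M / D`. -/
lemma supportDim_quotient_eq_of_lt {M : Type*} [AddCommGroup M] [Module R M] (D : Submodule R M)
    (h : Module.supportDim R D < Module.supportDim R M) :
    Module.supportDim R (M ⧸ D) = Module.supportDim R M := by
  refine le_antisymm (Module.supportDim_le_of_surjective _ D.mkQ_surjective) ?_
  have hmax : Module.supportDim R M ≤
      max (Module.supportDim R D) (Module.supportDim R (M ⧸ D)) := by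
    refine supportDim_le_iff.2 fun p hp => ?_
    rw [Module.support_of_exact (LinearMap.exact_subtype_mkQ D) D.subtype_injective
      D.mkQ_surjective] at hp
    exact hp.elim (fun hp => le_max_of_le_left (supportDim_le_iff.1 le_rfl p hp))
      fun hp => le_max_of_le_right (supportDim_le_iff.1 le_rfl p hp)
  exact (le_max_iff.1 hmax).resolve_left h.not_ge

variable [IsLocalRing R] [IsNoetherianRing R]

lemma supportDim_lt_top (N : Type*) [AddCommGroup N] [Module R N] : Module.supportDim R N < ⊤ :=
  (Module.supportDim_le_ringKrullDim R N).trans_lt ringKrullDim_lt_top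

lemma coe_dim_eq_supportDim (N : Type*) [AddCommGroup N] [Module R N] [Nontrivial N] :
    ((dim R N : ℕ) : WithBot ℕ∞) = Module.supportDim R N := by
  have h1 := Module.supportDim_ne_bot_of_nontrivial R N
  have h2 := (supportDim_lt_top (R := R) N).ne
  rw [dim]
  generalize Module.supportDim R N = a at h1 h2
  lift a to ℕ∞ using h1
  lift a to ℕ using (by simpa using h2)
  rfl

lemma supportDim_le_coe_dim (N : Type*) [AddCommGroup N] [Module R N] :
    Module.supportDim R N ≤ (dim R N : ℕ) := by
  rcases subsingleton_or_nontrivial N with _ | _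
  · rw [Module.supportDim_eq_bot_of_subsingleton]
    exact bot_le
  · exact (coe_dim_eq_supportDim N).ge

lemma dim_le_of_supportDim_le {N N' : Type*} [AddCommGroup N] [Module R N]
    [AddCommGroup N'] [Module R N'] (h : Module.supportDim R N ≤ Module.supportDim R N') :
    dim R N ≤ dim R N' := by
  rcases subsingleton_or_nontrivial N with _ | _
  · rw [dim, Module.supportDim_eq_bot_of_subsingleton]
    exact Nat.zero_le _
  · have h1 := (coe_dim_eq_supportDim (R := R) N).le.trans (h.trans (supportDim_le_coe_dim N'))
    exact_mod_cast h1

omit [IsNoetherianRing R] in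
lemma supportDim_le_zero_of_pow_le_annihilator {N : Type*} [AddCommGroup N] [Module R N]
    {k : ℕ} (h : maximalIdeal R ^ k ≤ Module.annihilator R N) : Module.supportDim R N ≤ 0 := by
  refine supportDim_le_iff.2 fun p hp => ?_
  have h1 : maximalIdeal R ≤ p.asIdeal :=
    p.isPrime.le_of_pow_le (h.trans (Module.annihilator_le_of_mem_support hp))
  rw [← (maximalIdeal.isMaximal R).eq_of_le p.isPrime.ne_top h1,
    Module.supportDim_quotient_eq_ringKrullDim]
  exact (ringKrullDim_eq_zero_of_isField
    ((Ideal.Quotient.maximal_ideal_iff_isField_quotient _).1 (maximalIdeal.isMaximal R))).le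

lemma length_quotient_maximalIdeal_ne_top (N : Type*) [AddCommGroup N] [Module R N]
    [Module.Finite R N] :
    Module.length R (N ⧸ maximalIdeal R • (⊤ : Submodule R N)) ≠ ⊤ := by
  let := Ideal.Quotient.field (maximalIdeal R)
  rw [Module.length_eq_of_surjective (R := R ⧸ maximalIdeal R) Ideal.Quotient.mk_surjective]
  have : Module.Finite (R ⧸ maximalIdeal R) (N ⧸ maximalIdeal R • (⊤ : Submodule R N)) :=
    Module.Finite.of_restrictScalars_finite R _ _
  exact Module.length_ne_top

lemma isFiniteLength_iff_supportDim_le_zero {N : Type*} [AddCommGroup N] [Module R N]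
    [Module.Finite R N] : IsFiniteLength R N ↔ Module.supportDim R N ≤ 0 := by
  constructor
  · intro h
    have hart := (isFiniteLength_iff_isNoetherian_isArtinian.1 h).2
    obtain ⟨k, hk⟩ := IsArtinian.monotone_stabilizes (R := R) (M := N)
      ⟨fun n => OrderDual.toDual (maximalIdeal R ^ n • (⊤ : Submodule R N)),
        fun m n hmn => Submodule.smul_mono_left (Ideal.pow_le_pow_right hmn)⟩
    have h1 : maximalIdeal R ^ k • (⊤ : Submodule R N) =
        maximalIdeal R ^ (k + 1) • (⊤ : Submodule R N) := hk (k + 1) k.le_succ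
    have h2 : maximalIdeal R ^ k • (⊤ : Submodule R N) = ⊥ := by
      refine Submodule.eq_bot_of_le_smul_of_le_jacobson_bot (maximalIdeal R) _
        (IsNoetherian.noetherian _) ?_ (maximalIdeal_le_jacobson ⊥)
      rw [← Submodule.mul_smul, ← pow_succ']
      exact h1.le
    refine supportDim_le_zero_of_pow_le_annihilator (k := k) fun a ha => ?_
    rw [Module.mem_annihilator]
    intro z
    rw [← Submodule.mem_bot R, ← h2]
    exact Submodule.smul_mem_smul ha trivial
  · intro h
    have h1 : maximalIdeal R ≤ (Module.annihilator R N).radical := by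
      rw [Ideal.radical_eq_sInf]
      refine le_sInf ?_
      rintro p ⟨hp, hprime⟩
      by_contra hcon
      have hlt : (⟨p, hprime⟩ : PrimeSpectrum R) < closedPoint R :=
        lt_of_le_not_ge (le_maximalIdeal hprime.ne_top) hcon
      have h2 := (supportDim_le_iff.1 h) ⟨p, hprime⟩ (Module.mem_support_iff_of_finite.2 hp)
      have h3 := (supportDim_quotient_add_one_le hlt).trans h2
      have h4 := (add_le_add_left (supportDim_quotient_prime_nonneg (closedPoint R)) 1).trans h3
      rw [zero_add] at h4
      exact absurd h4 (not_le.2 zero_lt_one)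
    obtain ⟨k, hk⟩ := Ideal.exists_pow_le_of_le_radical_of_fg h1 (IsNoetherian.noetherian _)
    obtain ⟨s, hs⟩ := (IsNoetherian.noetherian (maximalIdeal R) : (maximalIdeal R).FG)
    have hs' : Ideal.ofList s.toList = maximalIdeal R := by
      rw [← hs]
      exact congrArg Ideal.span (by ext; simp)
    have h2 := length_quotient_pow_le (N := N) s.toList k
    rw [hs'] at h2
    have h3 : maximalIdeal R ^ (k + 1) • (⊤ : Submodule R N) = ⊥ := by
      rw [eq_bot_iff, Submodule.smul_le]
      intro a ha z _
      exact Module.mem_annihilator.1 (hk (Ideal.pow_le_pow_right k.le_succ ha)) z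
    rw [← Module.length_ne_top_iff, ← (Submodule.quotEquivOfEqBot _ h3).length_eq]
    exact ne_top_of_le_ne_top
      (WithTop.mul_ne_top (ENat.natCast_ne_top _) (length_quotient_maximalIdeal_ne_top N)) h2

end Dimension

/-! ### Systems of parameters of Cohen-Macaulay modules -/

section CohenMacaulay

universe u v

open CategoryTheory Abelian in
/-- By the Rees theorem, dividing out a regular element lowers the depth by at most one: the depth
is characterized by the vanishing of `Ext` groups, which pass through a long exact sequence. -/
lemma exists_isRegular_quotSMulTop {R : Type u} [CommRing R] [IsLocalRing R] [IsNoetherianRing R]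
    {N : Type v} [AddCommGroup N] [Module R N] [Module.Finite R N] {d : ℕ}
    (h : ∃ ys : List R, ys.length = d + 1 ∧ (∀ y ∈ ys, y ∈ maximalIdeal R) ∧ IsRegular N ys)
    {x : R} (hx : x ∈ maximalIdeal R) (hreg : IsSMulRegular N x) :
    ∃ ys : List R, ys.length = d ∧ (∀ y ∈ ys, y ∈ maximalIdeal R) ∧
      IsRegular (QuotSMulTop x N) ys := by
  obtain ⟨ys, hlen, hys, hyreg⟩ := h
  have : Nontrivial N := hyreg.nontrivial
  -- The Rees theorem needs the module in a universe that can hold a copy of the ring.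
  let e : ULift.{u} N ≃ₗ[R] N := ULift.moduleEquiv
  let e' : QuotSMulTop x (ULift.{u} N) ≃ₗ[R] QuotSMulTop x N := QuotSMulTop.congr x e
  have hreg' : IsSMulRegular (ULift.{u} N) x := (e.isSMulRegular_congr x).2 hreg
  have : Nontrivial (QuotSMulTop x N) := nontrivial_quotSMulTop_of_mem_maximalIdeal N hx
  have : Nontrivial (QuotSMulTop x (ULift.{u} N)) := e'.toEquiv.nontrivial
  have hlt : ∀ (P : Type max u v) [AddCommGroup P] [Module R P] [Module.Finite R P]
      [Nontrivial P], maximalIdeal R • (⊤ : Submodule R P) < ⊤ := by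
    intro P _ _ _ _
    exact lt_top_iff_ne_top.2
      (Submodule.top_ne_ideal_smul_of_le_jacobson_annihilator (maximalIdeal_le_jacobson _)).symm
  let A : ModuleCat.{max u v} R := ModuleCat.of R (ULift.{u} N)
  have hiff := (ModuleCat.exists_isRegular_tfae (maximalIdeal R) (d + 1) A (hlt _)).out 3 1
  have hext := hiff.1 ⟨ys, hlen, hys, (e.isRegular_congr ys).2 hyreg⟩
  have hiff' := (ModuleCat.exists_isRegular_tfae (maximalIdeal R) d
    (ModuleCat.of R (QuotSMulTop x (ULift.{u} N))) (hlt _)).out 1 3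
  obtain ⟨zs, hzlen, hzs, hzreg⟩ := hiff'.1 fun i hi => by
      have zero1 := AddCommGrpCat.isZero_of_iff_subsingleton.mpr (hext i (by omega))
      have zero2 := AddCommGrpCat.isZero_of_iff_subsingleton.mpr (hext (i + 1) (by omega))
      exact AddCommGrpCat.subsingleton_of_isZero <| ShortComplex.Exact.isZero_of_both_zeros
        (Ext.covariant_sequence_exact₃' _
          (IsSMulRegular.smulShortComplex_shortExact (M := A) hreg') i (i + 1) rfl)
        (zero1.eq_zero_of_src _) (zero2.eq_zero_of_tgt _)
  exact ⟨zs, hzlen, hzs, (e'.isRegular_congr zs).1 hzreg⟩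

variable {R : Type*} [CommRing R] [IsLocalRing R] [IsNoetherianRing R]

/-- The length of a regular sequence on `N` is at most `dim R / p` for each associated prime `p`
of `N`. -/
lemma length_le_supportDim_of_isAssociatedPrime {N : Type*} [AddCommGroup N] [Module R N]
    [Module.Finite R N] {ys : List R} (hmem : ∀ y ∈ ys, y ∈ maximalIdeal R)
    (hreg : IsWeaklyRegular N ys) {p : Ideal R} (hp : IsAssociatedPrime p N) :
    (ys.length : WithBot ℕ∞) ≤ Module.supportDim R (R ⧸ p) := by
  induction ys generalizing N p with
  | nil => exact supportDim_quotient_prime_nonneg ⟨p, hp.isPrime⟩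
  | cons y ys ih =>
    have hy := hmem y List.mem_cons_self
    obtain ⟨hy0, hreg'⟩ := (isWeaklyRegular_cons_iff _ _ _).1 hreg
    obtain ⟨hprime, z, hz⟩ := isAssociatedPrime_iff.1 hp
    have hz0 : z ≠ 0 := by
      rintro rfl
      exact hprime.ne_top (by rw [hz]; simp)
    let K : Submodule R N := Submodule.torsionBySet R N p
    have hzK : z ∈ K := by
      rw [Submodule.mem_torsionBySet_iff]
      rintro ⟨a, ha⟩
      rw [SetLike.mem_coe, hz, Submodule.mem_colon_singleton] at ha
      exact ha
    -- By Nakayama, the submodule killed by `p` is not contained in `y N`.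
    obtain ⟨v, hvK, hv⟩ : ∃ v ∈ K, v ∉ y • (⊤ : Submodule R N) := by
      by_contra! hcon
      have hK : K ≤ maximalIdeal R • K := by
        intro v hv
        obtain ⟨u, -, rfl⟩ := (Submodule.mem_smul_pointwise_iff_exists _ _ _).1 (hcon v hv)
        refine Submodule.smul_mem_smul hy ?_
        rw [Submodule.mem_torsionBySet_iff] at hv ⊢
        intro a
        refine hy0.right_eq_zero_of_smul ?_
        rw [smul_comm]
        exact hv a
      have hbot : K = ⊥ := Submodule.eq_bot_of_le_smul_of_le_jacobson_bot _ _
        (IsNoetherian.noetherian K) hK (maximalIdeal_le_jacobson ⊥)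
      rw [hbot] at hzK
      exact hz0 hzK
    obtain ⟨p', hp', hle⟩ := exists_le_isAssociatedPrime_of_isNoetherianRing R
      (Submodule.Quotient.mk v : QuotSMulTop y N)
      (by rwa [Ne, Submodule.Quotient.mk_eq_zero])
    have hpp' : p ≤ p' := by
      refine le_trans (fun a ha => ?_) hle
      rw [Submodule.mem_colon_singleton, Submodule.mem_bot, ← Submodule.Quotient.mk_smul,
        (Submodule.mem_torsionBySet_iff _ _).1 hvK ⟨a, ha⟩]
      rfl
    have hyp' : y ∈ p' := by
      refine hle ?_
      rw [Submodule.mem_colon_singleton, Submodule.mem_bot, ← Submodule.Quotient.mk_smul,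
        Submodule.Quotient.mk_eq_zero]
      exact Submodule.smul_mem_pointwise_smul _ _ _ trivial
    have hyp : y ∉ p := by
      intro h
      rw [hz, Submodule.mem_colon_singleton, Submodule.mem_bot] at h
      exact hz0 (hy0.right_eq_zero_of_smul h)
    have hlt : (⟨p, hprime⟩ : PrimeSpectrum R) < ⟨p', hp'.isPrime⟩ :=
      lt_of_le_not_ge hpp' fun h => hyp (h hyp')
    have h1 := ih (fun a ha => hmem a (List.mem_cons_of_mem _ ha)) hreg' hp'
    have h2 := supportDim_quotient_add_one_le hlt
    rw [List.length_cons, Nat.cast_succ]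
    exact (add_le_add_left h1 1).trans h2

lemma supportDim_le_supportDim_quotient_add_length {N : Type*} [AddCommGroup N] [Module R N]
    [Module.Finite R N] {xs : List R} (hxs : ∀ x ∈ xs, x ∈ maximalIdeal R) :
    Module.supportDim R N ≤
      Module.supportDim R (N ⧸ Ideal.ofList xs • (⊤ : Submodule R N)) + xs.length := by
  induction xs generalizing N with
  | nil =>
    rw [Ideal.ofList_nil, Submodule.bot_smul]
    simpa using (Module.supportDim_eq_of_equiv (Submodule.quotEquivOfEqBot ⊥ rfl)).ge
  | cons x xs ih =>
    refine (Module.supportDim_le_supportDim_quotSMulTop_succ (hxs x List.mem_cons_self)).trans ?_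
    refine (add_le_add_left
      (ih (N := QuotSMulTop x N) fun y hy => hxs y (List.mem_cons_of_mem _ hy)) 1).trans_eq ?_
    rw [Module.supportDim_eq_of_equiv
      (Submodule.quotOfListConsSMulTopEquivQuotSMulTopInner N x xs), List.length_cons, add_assoc]
    push_cast
    rfl

/-- A system of parameters of a Cohen-Macaulay module is a regular sequence. -/
lemma isWeaklyRegular_of_supportDim_quotient_le_zero {N : Type*} [AddCommGroup N] [Module R N]
    [Module.Finite R N] {xs : List R} (hxs : ∀ x ∈ xs, x ∈ maximalIdeal R)
    (h : ∃ ys : List R, ys.length = xs.length ∧ (∀ y ∈ ys, y ∈ maximalIdeal R) ∧ IsRegular N ys)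
    (hdim : Module.supportDim R (N ⧸ Ideal.ofList xs • (⊤ : Submodule R N)) ≤ 0) :
    IsWeaklyRegular N xs := by
  induction xs generalizing N with
  | nil => exact .nil R N
  | cons x xs ih =>
    have hx := hxs x List.mem_cons_self
    have hxs' : ∀ y ∈ xs, y ∈ maximalIdeal R := fun y hy => hxs y (List.mem_cons_of_mem _ hy)
    have hdim' : Module.supportDim R
        (QuotSMulTop x N ⧸ Ideal.ofList xs • (⊤ : Submodule R (QuotSMulTop x N))) ≤ 0 :=
      (Module.supportDim_eq_of_equiv
        (Submodule.quotOfListConsSMulTopEquivQuotSMulTopInner N x xs)).symm.trans_le hdim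
    -- A zero divisor `x` lies in some `p ∈ Ass N`, where `dim R / p = dim N`; then `N / x N` would
    -- still have the dimension of `N`, too large for the remaining parameters.
    have hreg : IsSMulRegular N x := by
      by_contra hcon
      have hmem : x ∈ ⋃ p ∈ associatedPrimes R N, (p : Set R) := by
        rw [biUnion_associatedPrimes_eq_compl_regular]
        exact hcon
      simp only [Set.mem_iUnion] at hmem
      obtain ⟨p, hp, hxp⟩ := hmem
      obtain ⟨ys, hlen, hys, hyreg⟩ := h
      have h1 := length_le_supportDim_of_isAssociatedPrime hys hyreg.toIsWeaklyRegular hp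
      have h2 : Module.supportDim R (R ⧸ p) ≤ Module.supportDim R (QuotSMulTop x N) := by
        refine supportDim_le_of_support_subset fun p' hp' => ?_
        rw [mem_support_quotient_iff] at hp'
        rw [Module.support_quotSMulTop]
        refine ⟨?_, by simpa using hp' hxp⟩
        obtain ⟨-, z, hz⟩ := isAssociatedPrime_iff.1 hp
        refine Module.mem_support_iff_exists_annihilator.2 ⟨z, ?_⟩
        refine le_trans (fun a ha => ?_) hp'
        rw [Submodule.mem_annihilator_span_singleton] at ha
        rwa [hz, Submodule.mem_colon_singleton]
      have h3 := supportDim_le_supportDim_quotient_add_length (N := QuotSMulTop x N) hxs'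
      have h4 := (h1.trans h2).trans (h3.trans (add_le_add_left hdim' _))
      rw [hlen, List.length_cons, zero_add] at h4
      have h5 : xs.length + 1 ≤ xs.length := by exact_mod_cast h4
      omega
    exact .cons hreg (ih hxs' (exists_isRegular_quotSMulTop h hx hreg) hdim')

lemma exists_isRegular_of_isCohenMacaulay {N : Type*} [AddCommGroup N] [Module R N]
    [Module.Finite R N] [Nontrivial N] (h : IsCohenMacaulay R N) :
    ∃ ys : List R, ys.length = dim R N ∧ (∀ y ∈ ys, y ∈ maximalIdeal R) ∧ IsRegular N ys := by
  have h1 := h.resolve_left (not_subsingleton N)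
  rw [← coe_dim_eq_supportDim N] at h1
  have h2 : depth R N = dim R N := by exact_mod_cast h1
  have : Nonempty {rs : List R // (∀ r ∈ rs, r ∈ maximalIdeal R) ∧ IsRegular N rs} :=
    ⟨⟨[], by simp, .nil R N⟩⟩
  have h3 : depth R N < ⊤ := by
    rw [h2]
    exact ENat.natCast_lt_top _
  obtain ⟨⟨ys, hys, hreg⟩, h4⟩ := ENat.exists_eq_iSup_of_lt_top h3
  refine ⟨ys, ?_, hys, hreg⟩
  have h5 := h4.trans h2
  exact_mod_cast h5

lemma isCohenMacaulay_of_isWeaklyRegular {N : Type*} [AddCommGroup N] [Module R N]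
    [Module.Finite R N] {xs : List R} (hxs : ∀ x ∈ xs, x ∈ maximalIdeal R)
    (hlen : xs.length = dim R N) (hreg : IsWeaklyRegular N xs) : IsCohenMacaulay R N := by
  rcases subsingleton_or_nontrivial N with hN | hN
  · exact .inl hN
  refine .inr ?_
  rw [← coe_dim_eq_supportDim N]
  suffices depth R N = dim R N by rw [this]; rfl
  refine le_antisymm (iSup_le ?_) ?_
  · rintro ⟨rs, hrs, hrreg⟩
    have h1 := Module.supportDim_add_length_eq_supportDim_of_isRegular rs hrreg
    rw [← coe_dim_eq_supportDim N] at h1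
    have h2 : (0 : WithBot ℕ∞) ≤
        Module.supportDim R (N ⧸ Ideal.ofList rs • (⊤ : Submodule R N)) := by
      have := hrreg.quot_ofList_smul_nontrivial
      rw [← coe_dim_eq_supportDim]
      exact_mod_cast Nat.zero_le _
    have h3 := (add_le_add_left h2 (rs.length : WithBot ℕ∞)).trans_eq h1
    rw [zero_add] at h3
    exact_mod_cast h3
  · rw [← hlen]
    exact le_iSup_of_le (⟨xs, hxs,
      (IsLocalRing.isRegular_iff_isWeaklyRegular_of_subset_maximalIdeal hxs).2 hreg⟩ :
      {rs : List R // (∀ r ∈ rs, r ∈ maximalIdeal R) ∧ IsRegular N rs}) le_rfl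

end CohenMacaulay

/-! ### Existence of good systems of parameters -/

section Existence

variable {R : Type*} [CommRing R]

lemma le_of_add_one_le_natCast_add_one {a : WithBot ℕ∞} {d : ℕ}
    (h : a + 1 ≤ ((d + 1 : ℕ) : WithBot ℕ∞)) :
    a ≤ d := by
  induction a with
  | bot => exact bot_le
  | coe a =>
    induction a with
    | top =>
      have h' : (⊤ : ℕ∞) + 1 ≤ ((d + 1 : ℕ) : ℕ∞) := WithBot.coe_le_coe.1 h
      rw [top_add, top_le_iff] at h'
      exact absurd h' (ENat.natCast_ne_top _)
    | coe a =>
      have h' : a + 1 ≤ d + 1 := by exact_mod_cast h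
      have h'' : a ≤ d := by omega
      exact_mod_cast h''

variable [IsLocalRing R] [IsNoetherianRing R]

/-- Prime avoidance: if the closed set `V(I)` has dimension at most `d`, and its intersection with
`V(c j)` has dimension at most `j` for all `j < d`, then `V(I)` can be cut down to dimension `0` by
elements `x j ∈ c j` with `j < d`. They are chosen from `j = d - 1` downwards. -/
lemma exists_forall_mem_and_supportDim_le_zero (c : ℕ → Ideal R) (d : ℕ) (I : Ideal R)
    (hI : ∀ p : PrimeSpectrum R, I ≤ p.asIdeal → Module.supportDim R (R ⧸ p.asIdeal) ≤ d)
    (hc : ∀ j < d, ∀ p : PrimeSpectrum R, I ≤ p.asIdeal → c j ≤ p.asIdeal →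
      Module.supportDim R (R ⧸ p.asIdeal) ≤ j) :
    ∃ x : ℕ → R, (∀ j < d, x j ∈ c j ∧ x j ∈ maximalIdeal R) ∧
      ∀ p : PrimeSpectrum R, I ≤ p.asIdeal → (∀ j < d, x j ∈ p.asIdeal) →
        Module.supportDim R (R ⧸ p.asIdeal) ≤ 0 := by
  induction d generalizing I with
  | zero => exact ⟨0, by simp, fun p hp _ => by simpa using hI p hp⟩
  | succ d ih =>
    obtain ⟨y, hyc, hy⟩ : ∃ y ∈ c d ⊓ maximalIdeal R, ∀ r : PrimeSpectrum R,
        r.asIdeal ∈ I.minimalPrimes → y ∈ r.asIdeal →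
          Module.supportDim R (R ⧸ r.asIdeal) ≤ d := by
      by_contra! hcon
      let S : Set (Ideal R) :=
        {r | r ∈ I.minimalPrimes ∧ ¬ Module.supportDim R (R ⧸ r) ≤ d}
      have hS : S.Finite := I.finite_minimalPrimes_of_isNoetherianRing.subset fun r hr => hr.1
      obtain ⟨r, ⟨hrI, hrd⟩, hr⟩ := (Ideal.subset_union_prime_finite hS (f := id) ⊥ ⊥
        (I := c d ⊓ maximalIdeal R) fun r hr _ _ => hr.1.1.1).1 fun y hy => by
          obtain ⟨r, hr, hyr, hrd⟩ := hcon y hy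
          exact Set.mem_biUnion (x := r.asIdeal) ⟨hr, hrd.not_ge⟩ hyr
      have hprime : r.IsPrime := hrI.1.1
      rcases hprime.inf_le.1 hr with h | h
      · exact hrd (hc d d.lt_succ_self ⟨r, hprime⟩ hrI.1.2 h)
      · refine hrd ?_
        have h0 : Module.supportDim R (R ⧸ r) ≤ 0 :=
          supportDim_le_zero_of_pow_le_annihilator (k := 1)
            (by rwa [Ideal.annihilator_quotient, pow_one])
        exact h0.trans (by exact_mod_cast Nat.zero_le d)
    obtain ⟨x, hx, hxI⟩ := ih (I ⊔ Ideal.span {y})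
      (fun p hp => by
        obtain ⟨r, hr, hrp⟩ := Ideal.exists_minimalPrimes_le (le_sup_left.trans hp)
        have hprime : r.IsPrime := hr.1.1
        by_cases hyr : y ∈ r
        · exact (supportDim_quotient_mono hrp).trans (hy ⟨r, hprime⟩ hr hyr)
        · have hyp : y ∈ p.asIdeal :=
            hp (Ideal.mem_sup_right (Ideal.mem_span_singleton_self y))
          have hlt : (⟨r, hprime⟩ : PrimeSpectrum R) < p :=
            lt_of_le_not_ge hrp fun h => hyr (h hyp)
          exact le_of_add_one_le_natCast_add_one
            ((supportDim_quotient_add_one_le hlt).trans (hI ⟨r, hprime⟩ hr.1.2)))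
      fun j hj p hp => hc j (hj.trans d.lt_succ_self) p (le_sup_left.trans hp)
    refine ⟨Function.update x d y, fun j hj => ?_, fun p hp hxp => hxI p ?_ fun j hj => ?_⟩
    · rcases (Nat.lt_succ_iff_lt_or_eq.1 hj) with hj | rfl
      · rw [Function.update_of_ne hj.ne]
        exact hx j hj
      · rw [Function.update_self]
        exact hyc
    · refine sup_le hp ((Ideal.span_singleton_le_iff_mem _).2 ?_)
      simpa using hxp d d.lt_succ_self
    · simpa [Function.update_of_ne hj.ne] using hxp j (hj.trans d.lt_succ_self)

variable {M : Type*} [AddCommGroup M] [Module R M] [Module.Finite R M]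

omit [IsLocalRing R] in
/-- A consequence of the Artin-Rees lemma. -/
lemma exists_pow_annihilator_smul_top_inf_eq_bot (D : Submodule R M) :
    ∃ k : ℕ, D ⊓ (Module.annihilator R D ^ k • ⊤ : Submodule R M) = ⊥ := by
  obtain ⟨k, hk⟩ := Ideal.exists_pow_inf_eq_pow_smul (Module.annihilator R D) D
  refine ⟨k + 1, ?_⟩
  rw [inf_comm, hk (k + 1) k.le_succ, Nat.add_sub_cancel_left, pow_one, eq_bot_iff,
    Submodule.smul_le]
  rintro a ha z ⟨-, hz⟩
  exact congrArg Subtype.val (Module.mem_annihilator.1 ha ⟨z, hz⟩)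

omit [IsLocalRing R] [IsNoetherianRing R] in
lemma mem_support_quotient_smul_top_iff {N : Type*} [AddCommGroup N] [Module R N]
    [Module.Finite R N] {q : Ideal R} {p : PrimeSpectrum R} :
    p ∈ Module.support R (N ⧸ q • (⊤ : Submodule R N)) ↔
      p ∈ Module.support R N ∧ q ≤ p.asIdeal := by
  rw [Module.support_quotient]
  rfl

/-- The element with index `j` is taken from powers of the annihilators of the `D_i` with
`d_i ≤ j`, so that Artin-Rees makes the system good; such powers define closed sets of dimension at
most `j`, so that prime avoidance applies. -/
lemma exists_isGoodSystemOfParameters (F : DimensionFiltration R M) :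
    ∃ x : Fin (dim R M) → R, IsGoodSystemOfParameters M x := by
  choose k hk using fun i : Fin F.length =>
    exists_pow_annihilator_smul_top_inf_eq_bot (F.D i.castSucc)
  let a : Fin F.length → Ideal R := fun i => Module.annihilator R (F.D i.castSucc) ^ k i
  let c : ℕ → Ideal R := fun j =>
    (Finset.univ.filter fun i : Fin F.length => dim R (F.D i.castSucc) ≤ j).inf a
  obtain ⟨x, hx, hxp⟩ := exists_forall_mem_and_supportDim_le_zero c (dim R M)
    (Module.annihilator R M)
    (fun p hp => (supportDim_le_iff.1 (supportDim_le_coe_dim M)) p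
      (Module.mem_support_iff_of_finite.2 hp))
    (fun j hj p hp hcp => by
      obtain ⟨i, hi, hip⟩ := (Ideal.IsPrime.inf_le' p.isPrime).1 hcp
      rw [Finset.mem_filter] at hi
      refine le_trans ((supportDim_le_iff.1 (supportDim_le_coe_dim (F.D i.castSucc))) p
        (Module.mem_support_iff_of_finite.2 (p.isPrime.le_of_pow_le hip))) ?_
      exact_mod_cast hi.2)
  refine ⟨fun j => x j, ⟨fun j => (hx j j.2).2, ?_⟩, F, fun i => ?_⟩
  · rw [isFiniteLength_iff_supportDim_le_zero]
    refine supportDim_le_iff.2 fun p hp => ?_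
    rw [mem_support_quotient_smul_top_iff] at hp
    exact hxp p (Module.mem_support_iff_of_finite.1 hp.1) fun j hj =>
      hp.2 (Ideal.subset_span ⟨⟨j, hj⟩, rfl⟩)
  · rw [eq_bot_iff, ← hk i]
    refine inf_le_inf_left _ (Submodule.smul_mono_left (Ideal.span_le.2 ?_))
    rintro _ ⟨j, hj, rfl⟩
    exact (Finset.inf_le (f := a) (Finset.mem_filter.2 ⟨Finset.mem_univ i, hj⟩)) (hx j j.2).1

end Existence

/-! ### Lengths along a filtration -/

section Filtration

variable {R : Type*} [CommRing R]

lemma le_add_sum_of_succ_le {t : ℕ} {a : Fin (t + 1) → ℕ∞} {b : Fin t → ℕ∞}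
    (h : ∀ i, a i.succ ≤ a i.castSucc + b i) : a (Fin.last t) ≤ a 0 + ∑ i, b i := by
  induction t with
  | zero => simp
  | succ t ih =>
    rw [Fin.sum_univ_castSucc, ← add_assoc, ← Fin.succ_last]
    exact (h (Fin.last t)).trans (add_le_add_left
      (ih (a := fun i => a i.castSucc) (b := fun i => b i.castSucc) fun i => h i.castSucc) _)

lemma eq_add_sum_of_succ_eq {t : ℕ} {a : Fin (t + 1) → ℕ∞} {b : Fin t → ℕ∞}
    (h : ∀ i, a i.succ = a i.castSucc + b i) : a (Fin.last t) = a 0 + ∑ i, b i := by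
  induction t with
  | zero => simp
  | succ t ih =>
    rw [Fin.sum_univ_castSucc, ← add_assoc, ← Fin.succ_last, h (Fin.last t)]
    exact congrArg (· + _)
      (ih (a := fun i => a i.castSucc) (b := fun i => b i.castSucc) fun i => h i.castSucc)

lemma eq_of_sum_le_sum {ι : Type*} [Fintype ι] {a b : ι → ℕ∞} (h : ∀ i, a i ≤ b i)
    (hsum : ∑ i, b i ≤ ∑ i, a i) (hb : ∀ i, b i ≠ ⊤) (i : ι) : a i = b i := by
  have ha : ∀ i, a i ≠ ⊤ := fun i => ne_top_of_le_ne_top (hb i) (h i)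
  lift a to ι → ℕ using ha
  lift b to ι → ℕ using hb
  beta_reduce at h hsum
  have h' : ∀ i, a i ≤ b i := fun i => by exact_mod_cast h i
  have hsum' : ∑ i, b i ≤ ∑ i, a i := by exact_mod_cast hsum
  exact congrArg Nat.cast ((Finset.sum_eq_sum_iff_of_le fun i _ => h' i).1
    (le_antisymm (Finset.sum_le_sum fun i _ => h' i) hsum') i (Finset.mem_univ i))

variable {M : Type*} [AddCommGroup M] [Module R M]

lemma exists_exact_quotient_smul_top (D : Submodule R M) (J : Ideal R) :
    ∃ (f : (D ⧸ J • (⊤ : Submodule R D)) →ₗ[R] M ⧸ J • (⊤ : Submodule R M))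
      (g : (M ⧸ J • (⊤ : Submodule R M)) →ₗ[R] (M ⧸ D) ⧸ J • (⊤ : Submodule R (M ⧸ D))),
      (∀ z : D, f (Submodule.Quotient.mk z) = Submodule.Quotient.mk (z : M)) ∧
      Function.Exact f g ∧ Function.Surjective g := by
  refine ⟨Submodule.mapQ _ _ D.subtype (Submodule.smul_top_le_comap_smul_top _ _),
    Submodule.mapQ _ _ D.mkQ (Submodule.smul_top_le_comap_smul_top _ _), fun _ => rfl, ?_, ?_⟩
  · intro z
    obtain ⟨z, rfl⟩ := Submodule.Quotient.mk_surjective _ z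
    rw [Submodule.mapQ_apply, Submodule.Quotient.mk_eq_zero, Submodule.mkQ_apply,
      mk_mem_smul_top_iff, Submodule.mem_sup]
    constructor
    · rintro ⟨y, hy, a, ha, rfl⟩
      refine ⟨Submodule.Quotient.mk ⟨y, hy⟩, ?_⟩
      rw [Submodule.mapQ_apply, Submodule.Quotient.eq]
      simpa using ha
    · rintro ⟨y, hy⟩
      obtain ⟨y, rfl⟩ := Submodule.Quotient.mk_surjective _ y
      rw [Submodule.mapQ_apply, eq_comm, Submodule.Quotient.eq] at hy
      exact ⟨y, y.2, _, hy, by simp⟩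
  · intro y
    obtain ⟨y, rfl⟩ := Submodule.Quotient.mk_surjective _ y
    obtain ⟨y, rfl⟩ := Submodule.Quotient.mk_surjective _ y
    exact ⟨Submodule.Quotient.mk y, rfl⟩

lemma length_quotient_smul_top_le_add (D : Submodule R M) (J : Ideal R) :
    Module.length R (M ⧸ J • (⊤ : Submodule R M)) ≤
      Module.length R (D ⧸ J • (⊤ : Submodule R D)) +
        Module.length R ((M ⧸ D) ⧸ J • (⊤ : Submodule R (M ⧸ D))) := by
  obtain ⟨f, g, -, hfg, hg⟩ := exists_exact_quotient_smul_top D J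
  have hfg' : Function.Exact (LinearMap.range f).subtype g := by
    rw [LinearMap.exact_iff] at hfg ⊢
    rw [hfg, Submodule.range_subtype]
  rw [Module.length_eq_add_of_exact _ g (Submodule.subtype_injective _) hg hfg']
  exact add_le_add_left (Module.length_le_of_surjective f.rangeRestrict
    f.surjective_rangeRestrict) _

lemma length_quotient_smul_top_eq_add {D : Submodule R M} {J : Ideal R}
    (h : J • (⊤ : Submodule R M) ⊓ D ≤ J • D) :
    Module.length R (M ⧸ J • (⊤ : Submodule R M)) =
      Module.length R (D ⧸ J • (⊤ : Submodule R D)) +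
        Module.length R ((M ⧸ D) ⧸ J • (⊤ : Submodule R (M ⧸ D))) := by
  obtain ⟨f, g, hf, hfg, hg⟩ := exists_exact_quotient_smul_top D J
  refine Module.length_eq_add_of_exact f g ?_ hg hfg
  rw [← LinearMap.ker_eq_bot, LinearMap.ker_eq_bot']
  intro z hz
  obtain ⟨z, rfl⟩ := Submodule.Quotient.mk_surjective _ z
  rw [hf, Submodule.Quotient.mk_eq_zero] at hz
  rw [Submodule.Quotient.mk_eq_zero]
  have h1 : J • D = (J • (⊤ : Submodule R D)).map D.subtype := by
    rw [Submodule.map_smul'', Submodule.map_top, Submodule.range_subtype]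
  obtain ⟨y, hy, hyz⟩ := h1 ▸ h ⟨hz, z.2⟩
  rwa [← Subtype.ext hyz]

lemma length_quotient_smul_top_congr {N N' : Type*} [AddCommGroup N] [Module R N]
    [AddCommGroup N'] [Module R N'] (e : N ≃ₗ[R] N') (J : Ideal R) :
    Module.length R (N ⧸ J • (⊤ : Submodule R N)) =
      Module.length R (N' ⧸ J • (⊤ : Submodule R N')) :=
  (Submodule.Quotient.equiv _ _ e (by
    rw [Submodule.map_smul'', Submodule.map_top, LinearEquiv.range])).length_eq

lemma sup_pow_smul_top_eq {N : Type*} [AddCommGroup N] [Module R N] (I : Ideal R) {J : Ideal R}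
    (hJ : J ≤ Module.annihilator R N) (n : ℕ) :
    (I ⊔ J) ^ n • (⊤ : Submodule R N) = I ^ n • (⊤ : Submodule R N) := by
  have hbot : ∀ P : Submodule R N, J • P = ⊥ := fun P => by
    rw [eq_bot_iff, Submodule.smul_le]
    exact fun a ha z _ => Module.mem_annihilator.1 (hJ ha) z
  induction n with
  | zero => simp
  | succ n ih =>
    rw [pow_succ', Submodule.mul_smul, ih, Submodule.sup_smul, hbot, sup_bot_eq, pow_succ',
      Submodule.mul_smul]

lemma ofList_eq_take_sup_drop (xs : List R) (k : ℕ) :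
    Ideal.ofList xs = Ideal.ofList (xs.take k) ⊔ Ideal.ofList (xs.drop k) := by
  rw [← Ideal.ofList_append, List.take_append_drop]

end Filtration

/-! ### Good systems of parameters and the dimension filtration -/

section Good

variable {R : Type*} [CommRing R] [IsLocalRing R] [IsNoetherianRing R]
  {M : Type*} [AddCommGroup M] [Module R M] [Module.Finite R M]

omit [Module.Finite R M] in
lemma dim_D_zero (F : DimensionFiltration R M) : dim R (F.D 0) = 0 := by
  have h : Module.supportDim R (F.D 0) ≤ 0 := by
    rw [F.D_zero]
    exact supportDim_primaryComponent_le_zero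
  rcases subsingleton_or_nontrivial (F.D 0) with _ | _
  · rw [dim, Module.supportDim_eq_bot_of_subsingleton]
    rfl
  · rw [← coe_dim_eq_supportDim] at h
    exact Nat.le_zero.1 (by exact_mod_cast h)

omit [Module.Finite R M] in
lemma dim_submodule_le (D : Submodule R M) : dim R D ≤ dim R M :=
  dim_le_of_supportDim_le (Module.supportDim_le_of_injective D.subtype D.subtype_injective)

omit [IsNoetherianRing R] [Module.Finite R M] in
lemma dim_factor (F : DimensionFiltration R M) (i : Fin F.length) :
    dim R (F.Factor i) = dim R (F.D i.succ) := by
  have hle := (F.isGreatest i).1.1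
  have h : Module.supportDim R ((F.D i.castSucc).submoduleOf (F.D i.succ)) <
      Module.supportDim R (F.D i.succ) :=
    (Module.supportDim_eq_of_equiv (Submodule.submoduleOfEquivOfLe hle)).trans_lt
      (F.isGreatest i).1.2
  rw [dim, supportDim_quotient_eq_of_lt _ h, dim]

omit [Module.Finite R M] in
lemma IsGoodSystemOfParameters.mem_annihilator {x : Fin (dim R M) → R}
    (hx : IsGoodSystemOfParameters M x) (F : DimensionFiltration R M) (k : Fin (F.length + 1))
    {j : Fin (dim R M)} (hj : dim R (F.D k) ≤ j) : x j ∈ Module.annihilator R (F.D k) := by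
  obtain ⟨-, F', hF⟩ := hx
  obtain rfl := Subsingleton.elim F F'
  induction k using Fin.lastCases with
  | last =>
    have h1 : dim R M ≤ dim R (F.D (Fin.last F.length)) := by
      rw [F.D_last]
      exact dim_le_of_supportDim_le (Module.supportDim_eq_of_equiv Submodule.topEquiv).ge
    omega
  | cast i =>
    rw [Module.mem_annihilator]
    intro z
    refine Subtype.ext ?_
    change x j • (z : M) = 0
    rw [← Submodule.mem_bot R, ← hF i]
    exact ⟨Submodule.smul_mem _ _ z.2, Submodule.smul_mem_smul (Ideal.subset_span ⟨j, hj, rfl⟩)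
      trivial⟩

omit [Module.Finite R M] in
lemma IsGoodSystemOfParameters.ofList_drop_le_annihilator {x : Fin (dim R M) → R}
    (hx : IsGoodSystemOfParameters M x) (F : DimensionFiltration R M) (k : Fin (F.length + 1)) :
    Ideal.ofList ((List.ofFn x).drop (dim R (F.D k))) ≤ Module.annihilator R (F.D k) := by
  refine Ideal.span_le.2 fun y hy => ?_
  obtain ⟨j, hj, rfl⟩ := List.mem_iff_getElem.1 hy
  rw [List.getElem_drop, List.getElem_ofFn]
  exact hx.mem_annihilator F k (Nat.le_add_right _ _)

omit [IsNoetherianRing R] [Module.Finite R M] in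
lemma IsSystemOfParameters.mem_maximalIdeal {x : Fin (dim R M) → R}
    (hx : IsSystemOfParameters M x) (k : ℕ) :
    ∀ y ∈ (List.ofFn x).take k, y ∈ maximalIdeal R := by
  intro y hy
  obtain ⟨j, rfl⟩ := (List.mem_ofFn' _ _).1 (List.mem_of_mem_take hy)
  exact hx.1 j

omit [IsLocalRing R] [IsNoetherianRing R] [Module.Finite R M] in
lemma span_range_eq_ofList (x : Fin (dim R M) → R) :
    Ideal.span (Set.range x) = Ideal.ofList (List.ofFn x) :=
  congrArg Ideal.span (by ext; simp [List.mem_ofFn'])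

omit [Module.Finite R M] in
lemma length_take_ofFn (x : Fin (dim R M) → R) (D : Submodule R M) :
    ((List.ofFn x).take (dim R D)).length = dim R D := by
  rw [List.length_take, List.length_ofFn, min_eq_left (dim_submodule_le D)]

omit [Module.Finite R M] in
/-- On `D_k`, and likewise on `D_k / D_{k-1}`, a good parameter ideal acts like the ideal generated
by the first `d_k` parameters. -/
lemma IsGoodSystemOfParameters.pow_smul_top_eq {x : Fin (dim R M) → R}
    (hx : IsGoodSystemOfParameters M x) (F : DimensionFiltration R M) (k : Fin (F.length + 1))
    {N : Type*} [AddCommGroup N] [Module R N]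
    (hN : Module.annihilator R (F.D k) ≤ Module.annihilator R N) (n : ℕ) :
    Ideal.ofList (List.ofFn x) ^ n • (⊤ : Submodule R N) =
      Ideal.ofList ((List.ofFn x).take (dim R (F.D k))) ^ n • (⊤ : Submodule R N) := by
  rw [ofList_eq_take_sup_drop _ (dim R (F.D k))]
  exact sup_pow_smul_top_eq _ ((hx.ofList_drop_le_annihilator F k).trans hN) n

omit [Module.Finite R M] in
lemma IsGoodSystemOfParameters.smul_top_eq {x : Fin (dim R M) → R}
    (hx : IsGoodSystemOfParameters M x) (F : DimensionFiltration R M) (k : Fin (F.length + 1))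
    {N : Type*} [AddCommGroup N] [Module R N]
    (hN : Module.annihilator R (F.D k) ≤ Module.annihilator R N) :
    Ideal.ofList (List.ofFn x) • (⊤ : Submodule R N) =
      Ideal.ofList ((List.ofFn x).take (dim R (F.D k))) • (⊤ : Submodule R N) := by
  simpa using hx.pow_smul_top_eq F k hN 1

omit [Module.Finite R M] in
lemma IsGoodSystemOfParameters.length_pow_le {x : Fin (dim R M) → R}
    (hx : IsGoodSystemOfParameters M x) (F : DimensionFiltration R M) (k : Fin (F.length + 1))
    {N : Type*} [AddCommGroup N] [Module R N]
    (hN : Module.annihilator R (F.D k) ≤ Module.annihilator R N) (n : ℕ) :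
    Module.length R (N ⧸ Ideal.ofList (List.ofFn x) ^ (n + 1) • (⊤ : Submodule R N)) ≤
      ((n + dim R (F.D k)).choose (dim R (F.D k)) : ℕ∞) *
        Module.length R (N ⧸ Ideal.ofList (List.ofFn x) • (⊤ : Submodule R N)) := by
  rw [hx.pow_smul_top_eq F k hN, hx.smul_top_eq F k hN]
  have h := length_quotient_pow_le (N := N) ((List.ofFn x).take (dim R (F.D k))) n
  rwa [length_take_ofFn] at h

omit [IsNoetherianRing R] [Module.Finite R M] in
lemma annihilator_le_annihilator_factor (F : DimensionFiltration R M) (i : Fin F.length) :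
    Module.annihilator R (F.D i.succ) ≤ Module.annihilator R (F.Factor i) :=
  LinearMap.annihilator_le_of_surjective _ (Submodule.mkQ_surjective _)

lemma IsGoodSystemOfParameters.supportDim_factor_le_zero {x : Fin (dim R M) → R}
    (hx : IsGoodSystemOfParameters M x) (F : DimensionFiltration R M) (i : Fin F.length) :
    Module.supportDim R (F.Factor i ⧸ Ideal.ofList (List.ofFn x) •
      (⊤ : Submodule R (F.Factor i))) ≤ 0 := by
  refine le_trans (supportDim_le_of_support_subset fun p hp => ?_)
    (isFiniteLength_iff_supportDim_le_zero.1 hx.1.2)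
  rw [mem_support_quotient_smul_top_iff] at hp ⊢
  refine ⟨?_, (span_range_eq_ofList x).trans_le hp.2⟩
  exact Module.support_subset_of_injective (F.D i.succ).subtype (Submodule.subtype_injective _)
    (Module.support_subset_of_surjective _ (Submodule.mkQ_surjective _) hp.1)

/-- If `𝒟_i` is Cohen-Macaulay, then the initial parameters are regular on it; this makes lengths
additive in this step of the filtration and determines the contribution of `𝒟_i`. -/
lemma IsGoodSystemOfParameters.length_pow_eq_of_isCohenMacaulay {x : Fin (dim R M) → R}
    (hx : IsGoodSystemOfParameters M x) (F : DimensionFiltration R M) (i : Fin F.length)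
    (h : IsCohenMacaulay R (F.Factor i)) (n : ℕ) :
    Module.length R
        (F.D i.succ ⧸ Ideal.ofList (List.ofFn x) ^ (n + 1) • (⊤ : Submodule R (F.D i.succ))) =
      Module.length R (F.D i.castSucc ⧸
        Ideal.ofList (List.ofFn x) ^ (n + 1) • (⊤ : Submodule R (F.D i.castSucc))) +
      ((n + dim R (F.D i.succ)).choose (dim R (F.D i.succ)) : ℕ∞) * Module.length R
        (F.Factor i ⧸ Ideal.ofList (List.ofFn x) • (⊤ : Submodule R (F.Factor i))) := by
  set xs := (List.ofFn x).take (dim R (F.D i.succ)) with hxs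
  have hmem := hx.1.mem_maximalIdeal (dim R (F.D i.succ))
  have hlen : xs.length = dim R (F.D i.succ) := length_take_ofFn x _
  have hann := annihilator_le_annihilator_factor F i
  have hreg : IsWeaklyRegular (F.Factor i) xs := by
    rcases subsingleton_or_nontrivial (F.Factor i) with hs | hs
    · exact ⟨fun _ _ => Function.injective_of_subsingleton _⟩
    · refine isWeaklyRegular_of_supportDim_quotient_le_zero hmem ?_ ?_
      · rw [hlen, ← dim_factor]
        exact exists_isRegular_of_isCohenMacaulay h
      · rw [← hx.smul_top_eq F i.succ hann]
        exact hx.supportDim_factor_le_zero F i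
  rw [length_quotient_smul_top_eq_add (D := (F.D i.castSucc).submoduleOf (F.D i.succ)),
    length_quotient_smul_top_congr (Submodule.submoduleOfEquivOfLe (F.isGreatest i).1.1)]
  · congr 1
    rw [hx.pow_smul_top_eq F i.succ hann, hx.smul_top_eq F i.succ hann,
      length_quotient_pow_eq hmem hreg, hlen]
  · rw [hx.pow_smul_top_eq F i.succ le_rfl]
    refine (pow_smul_top_inf_le_of_isWeaklyRegular _ hmem hreg (n + 1)).trans
      (Submodule.smul_mono_left (Ideal.pow_right_mono ?_ _))
    rw [ofList_eq_take_sup_drop (List.ofFn x) (dim R (F.D i.succ))]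
    exact le_sup_left

omit [IsNoetherianRing R] [Module.Finite R M] in
lemma hilbertSamuelIdentity_iff (F : DimensionFiltration R M) (q : Ideal R) (n : ℕ) :
    HilbertSamuelIdentity F q n ↔
      Module.length R (F.D (Fin.last F.length) ⧸
          q ^ (n + 1) • (⊤ : Submodule R (F.D (Fin.last F.length)))) =
        ((n + dim R (F.D 0)).choose (dim R (F.D 0)) : ℕ∞) *
            Module.length R (F.D 0 ⧸ (q • ⊤ : Submodule R (F.D 0))) +
          ∑ i : Fin F.length,
            ((n + dim R (F.D i.succ)).choose (dim R (F.D i.succ)) : ℕ∞) *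
              Module.length R (F.Factor i ⧸ (q • ⊤ : Submodule R (F.Factor i))) := by
  rw [HilbertSamuelIdentity, length_quotient_smul_top_congr
    ((LinearEquiv.ofEq _ _ F.D_last).trans Submodule.topEquiv)]

lemma IsGoodSystemOfParameters.hilbertSamuelIdentity {x : Fin (dim R M) → R}
    (hx : IsGoodSystemOfParameters M x) (F : DimensionFiltration R M)
    (h : ∀ i : Fin F.length, IsCohenMacaulay R (F.Factor i)) (n : ℕ) :
    HilbertSamuelIdentity F (Ideal.ofList (List.ofFn x)) n := by
  rw [hilbertSamuelIdentity_iff, eq_add_sum_of_succ_eq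
    (a := fun k => Module.length R (F.D k ⧸
      Ideal.ofList (List.ofFn x) ^ (n + 1) • (⊤ : Submodule R (F.D k))))
    fun i => hx.length_pow_eq_of_isCohenMacaulay F i (h i) n]
  congr 1
  -- As `d₀ = 0`, the ideal acts on `D₀` like the one generated by the empty sequence.
  have hnil : (List.ofFn x).take (dim R (F.D 0)) = [] := by rw [dim_D_zero, List.take_zero]
  rw [hx.pow_smul_top_eq F 0 le_rfl, hx.smul_top_eq F 0 le_rfl, hnil,
    length_quotient_pow_eq (by simp) (.nil R _), dim_D_zero, List.length_nil]

lemma IsGoodSystemOfParameters.length_factor_ne_top {x : Fin (dim R M) → R}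
    (hx : IsGoodSystemOfParameters M x) (F : DimensionFiltration R M) (i : Fin F.length) :
    Module.length R (F.Factor i ⧸ Ideal.ofList (List.ofFn x) •
      (⊤ : Submodule R (F.Factor i))) ≠ ⊤ :=
  Module.length_ne_top_iff.2
    (isFiniteLength_iff_supportDim_le_zero.2 (hx.supportDim_factor_le_zero F i))

/-- The lengths of the pieces `𝒟_i / 𝔮ⁿ⁺¹ 𝒟_i` add up to at least `ℓ(M / 𝔮ⁿ⁺¹ M)`, and each is
bounded by its term in the identity. If the bounds add up to `ℓ(M / 𝔮ⁿ⁺¹ M)`, all of them are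
attained. -/
lemma IsGoodSystemOfParameters.length_factor_pow_eq {x : Fin (dim R M) → R}
    (hx : IsGoodSystemOfParameters M x) (F : DimensionFiltration R M) (n : ℕ)
    (h : HilbertSamuelIdentity F (Ideal.ofList (List.ofFn x)) n) (i : Fin F.length) :
    Module.length R (F.Factor i ⧸
        Ideal.ofList (List.ofFn x) ^ (n + 1) • (⊤ : Submodule R (F.Factor i))) =
      ((n + dim R (F.D i.succ)).choose (dim R (F.D i.succ)) : ℕ∞) *
        Module.length R (F.Factor i ⧸ Ideal.ofList (List.ofFn x) •
          (⊤ : Submodule R (F.Factor i))) := by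
  have hfin : Module.length R (M ⧸
      Ideal.ofList (List.ofFn x) ^ (n + 1) • (⊤ : Submodule R M)) ≠ ⊤ := by
    refine ne_top_of_le_ne_top (WithTop.mul_ne_top (ENat.natCast_ne_top _) ?_)
      (length_quotient_pow_le (List.ofFn x) n)
    rw [← span_range_eq_ofList]
    exact Module.length_ne_top_iff.2 hx.1.2
  have hid := h
  rw [hilbertSamuelIdentity_iff] at h
  have hsum := le_add_sum_of_succ_le
    (a := fun k => Module.length R (F.D k ⧸
      Ideal.ofList (List.ofFn x) ^ (n + 1) • (⊤ : Submodule R (F.D k))))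
    (b := fun i => Module.length R (F.Factor i ⧸
      Ideal.ofList (List.ofFn x) ^ (n + 1) • (⊤ : Submodule R (F.Factor i)))) fun i => by
    refine (length_quotient_smul_top_le_add
      ((F.D i.castSucc).submoduleOf (F.D i.succ)) _).trans_eq ?_
    rw [length_quotient_smul_top_congr (Submodule.submoduleOfEquivOfLe (F.isGreatest i).1.1)]
  have hbound : ∀ i : Fin F.length, _ := fun i =>
    hx.length_pow_le F i.succ (annihilator_le_annihilator_factor F i) n
  have hbound0 := hx.length_pow_le F 0 le_rfl n
  have hle := (h.symm.trans_le hsum).trans (add_le_add_left hbound0 _)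
  have hne : ((n + dim R (F.D 0)).choose (dim R (F.D 0)) : ℕ∞) * Module.length R
      (F.D 0 ⧸ (Ideal.ofList (List.ofFn x) • ⊤ : Submodule R (F.D 0))) ≠ ⊤ :=
    ne_top_of_le_ne_top hfin (le_self_add.trans_eq hid.symm)
  have hle' := (WithTop.add_le_add_iff_left hne).1 hle
  exact eq_of_sum_le_sum hbound hle'
    (fun i => WithTop.mul_ne_top (ENat.natCast_ne_top _) (hx.length_factor_ne_top F i)) i

lemma IsGoodSystemOfParameters.isCohenMacaulay_factor {x : Fin (dim R M) → R}
    (hx : IsGoodSystemOfParameters M x) (F : DimensionFiltration R M)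
    (h : ∀ n, HilbertSamuelIdentity F (Ideal.ofList (List.ofFn x)) n) (i : Fin F.length) :
    IsCohenMacaulay R (F.Factor i) := by
  have hmem := hx.1.mem_maximalIdeal (dim R (F.D i.succ))
  have hlen := length_take_ofFn x (F.D i.succ)
  have hann := annihilator_le_annihilator_factor F i
  refine isCohenMacaulay_of_isWeaklyRegular hmem (hlen.trans (dim_factor F i).symm)
    (isWeaklyRegular_of_length_eq hmem ?_ fun n => ?_)
  · rw [← hx.smul_top_eq F i.succ hann]
    exact hx.length_factor_ne_top F i
  · rw [← hx.smul_top_eq F i.succ hann, ← hx.pow_smul_top_eq F i.succ hann, hlen]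
    exact hx.length_factor_pow_eq F n (h n) i

end Good

end SeqCM

theorem theorem4p3 {R : Type*} [CommRing R] [IsNoetherianRing R] [IsLocalRing R]
    {M : Type*} [AddCommGroup M] [Module R M] [Module.Finite R M]
    (F : SeqCM.DimensionFiltration R M) :
    List.TFAE [
      SeqCM.IsSequentiallyCohenMacaulay R M,
      ∀ q : Ideal R, SeqCM.IsGoodParameterIdeal M q →
        ∀ n : ℕ, SeqCM.HilbertSamuelIdentity F q n,
      ∃ q : Ideal R, SeqCM.IsGoodParameterIdeal M q ∧
        ∀ n : ℕ, SeqCM.HilbertSamuelIdentity F q n] := by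
  tfae_have 1 → 2 := by
    rintro ⟨F', hF'⟩ _ ⟨x, hx, rfl⟩ n
    obtain rfl := Subsingleton.elim F F'
    rw [SeqCM.span_range_eq_ofList]
    exact hx.hilbertSamuelIdentity F hF' n
  tfae_have 2 → 3 := by
    intro h
    obtain ⟨x, hx⟩ := SeqCM.exists_isGoodSystemOfParameters F
    exact ⟨_, ⟨x, hx, rfl⟩, h _ ⟨x, hx, rfl⟩⟩
  tfae_have 3 → 1 := by
    rintro ⟨_, ⟨x, hx, rfl⟩, h⟩
    rw [SeqCM.span_range_eq_ofList] at h
    exact ⟨F, fun i => hx.isCohenMacaulay_factor F h i⟩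
  tfae_finish
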